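/- Setting. Let $N\ge 3$, let $\alpha=(\alpha_1,\dots,\alpha_N)\in\mathbb R^N$, and let $y_1,\dots,y_N\in\mathbb R^2$ be $N$ distinct points. For $z\in\mathbb C^+=\{\operatorname{Im} z>0\}$ let $\mathcal G_z(x)=\frac i4H_0^{(1)}(z|x|)$ be the convolution kernel of $(-\Delta-z^2)^{-1}$ in $L^2(\mathbb R^2)$, and let $\Gamma_{\alpha,Y}(z)$ be the $N\times N$ matrix with diagonal entries $\alpha_j+\frac1{2\pi}\log\frac z2-\frac i4+\frac{\gamma}{2\pi}$ ($\gamma$ is Euler's constant, $\log$ the principal branch) and off-diagonal entries $-\mathcal G_z(y_j-y_k)$. The point-interaction operator $H_{\alpha,Y}$ is the self-adjoint operator in the complex Hilbert space $L^2(\mathbb R^2)$ such that, for every $z\in\mathbb C^+$ with $\Gamma_{\alpha,Y}(z)$ invertible, its domain consists of the functions $$u(x)=v(x)+\sum_{j,k=1}^N[\Gamma_{\alpha,Y}(z)^{-1}]_{jk}\,v(y_k)\,\mathcal G_z(x-y_j),\qquad v\in H^2(\mathbb R^2),$$ and $(H_{\alpha,Y}-z^2)u=(-\Delta-z^2)v$.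 Let $\tilde{\mathcal D}$ be the real symmetric $N\times N$ matrix with diagonal entries $\alpha_j$ and off-diagonal entries $\frac1{2\pi}\log|y_j-y_k|$. Proposition 1.2. (i) If $a\in\mathbb R^N\setminus\{0\}$ satisfies $$\sum_{j=1}^Na_j=0,\qquad \sum_{j=1}^Na_jy_j=0,\qquad \tilde{\mathcal D}a=0,\tag{$*$}$$ then the function $$\psi(x)=-\sum_{j=1}^N\frac{a_j}{2\pi}\log|x-y_j|\tag{$**$}$$ is a nonzero element of $L^2(\mathbb R^2)$, belongs to the domain of $H_{\alpha,Y}$, and satisfies $H_{\alpha,Y}\psi=0$. (ii) Conversely, every real-valued $\psi\ne0$ in the domain of $H_{\alpha,Y}$ with $H_{\alpha,Y}\psi=0$ is (almost everywhere) of the form $(**)$ with some $a\in\mathbb R^N\setminus\{0\}$ satisfying $(*)$; and every complex-valued $\psi\neq 0$ in the domain of $H_{\alpha,Y}$ with $H_{\alpha,Y}\psi=0$ is of the form $(**)$ with some $a\in\mathbb C^N\setminus\{0\}$ satisfying $(*)$. -/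

import Mathlib

open MeasureTheory
open scoped SchwartzMap Laplacian ENNReal

/-- The plane `ℝ²` with its Euclidean norm. -/
abbrev Plane : Type := EuclideanSpace ℝ (Fin 2)

/-- The complex Hilbert space `L²(ℝ²)` (Lebesgue measure). -/
abbrev L2Plane : Type := Lp ℂ 2 (volume : Measure Plane)

noncomputable section

/-- The Hankel function of the first kind and order zero on the open upper half-plane, through
Sommerfeld's integral `H₀⁽¹⁾(w) = (2 / (π i)) ∫₀^∞ exp (i w cosh t) dt`, which converges absolutely
for `Im w > 0`. -/
def hankelZero (w : ℂ) : ℂ :=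
  (2 / ((Real.pi : ℂ) * Complex.I)) *
    ∫ t in Set.Ioi (0 : ℝ), Complex.exp (Complex.I * w * ((Real.cosh t : ℝ) : ℂ))

/-- The convolution kernel `𝒢_z(x) = (i/4) H₀⁽¹⁾(z |x|)` of `(-Δ - z²)⁻¹` in `L²(ℝ²)`, for
`Im z > 0`. It is singular at `x = 0`, where the value given here is of no meaning. -/
def greenKernel (z : ℂ) (x : Plane) : ℂ :=
  (Complex.I / 4) * hankelZero (z * ((‖x‖ : ℝ) : ℂ))

variable {N : ℕ}

/-- The matrix `Γ_{α,Y}(z)`, for `Im z > 0` (principal branch of the logarithm, Euler's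
constant `γ`). -/
def gammaMatrix (α : Fin N → ℝ) (y : Fin N → Plane) (z : ℂ) : Matrix (Fin N) (Fin N) ℂ :=
  Matrix.of fun j k =>
    if j = k then
      (α j : ℂ) + 1 / (2 * (Real.pi : ℂ)) * Complex.log (z / 2) - Complex.I / 4
        + (Real.eulerMascheroniConstant : ℂ) / (2 * (Real.pi : ℂ))
    else -greenKernel z (y j - y k)

/-- The points `z` of the open upper half-plane at which `Γ_{α,Y}(z)` is invertible. -/
def admissible (α : Fin N → ℝ) (y : Fin N → Plane) : Set ℂ :=
  {z | 0 < z.im ∧ IsUnit (gammaMatrix α y z)}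

/-- For `v` the (continuous) `H²` function, the function
`v(x) + ∑_{j,k} [Γ_{α,Y}(z)⁻¹]_{jk} v(y_k) 𝒢_z(x - y_j)`. -/
def domainFunction (α : Fin N → ℝ) (y : Fin N → Plane) (z : ℂ) (v : Plane → ℂ) (x : Plane) : ℂ :=
  v x + ∑ j, ∑ k, (gammaMatrix α y z)⁻¹ j k * v (y k) * greenKernel z (x - y j)

/-- The graph of `H_{α,Y}` described at a point `z`: the pairs `(u, f)` in `L² × L²` for which there
is `v ∈ H²(ℝ²)` (with continuous representative `vc`) such that
`u(x) = v(x) + ∑_{j,k} [Γ_{α,Y}(z)⁻¹]_{jk} v(y_k) 𝒢_z(x - y_j)` almost everywhere and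
`f - z² u = (-Δ - z²) v`, the Laplacian being that of tempered distributions. -/
def pointInteractionGraphAt (α : Fin N → ℝ) (y : Fin N → Plane) (z : ℂ) :
    Submodule ℂ (L2Plane × L2Plane) where
  carrier := {p | ∃ (v : L2Plane) (vc : Plane → ℂ),
    TemperedDistribution.MemSobolev 2 2 (v : 𝓢'(Plane, ℂ)) ∧
    Continuous vc ∧ (v : Plane → ℂ) =ᵐ[volume] vc ∧
    (p.1 : Plane → ℂ) =ᵐ[volume] domainFunction α y z vc ∧
    ((p.2 - z ^ 2 • p.1 : L2Plane) : 𝓢'(Plane, ℂ))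
      = -Δ (v : 𝓢'(Plane, ℂ)) - z ^ 2 • (v : 𝓢'(Plane, ℂ))}
  zero_mem' := by
    refine ⟨0, fun _ => 0, ?_, continuous_const, Lp.coeFn_zero _ _ _, ?_, ?_⟩
    · rw [← Lp.toTemperedDistributionCLM_apply, map_zero]
      exact TemperedDistribution.memSobolev_fun_zero _ _ _ _
    · filter_upwards [Lp.coeFn_zero ℂ 2 (volume : Measure Plane)] with x hx
      simp [domainFunction, hx]
    · simp only [← Lp.toTemperedDistributionCLM_apply, Prod.fst_zero, Prod.snd_zero,
        smul_zero, sub_zero, map_zero, ← TemperedDistribution.laplacianCLM_apply, neg_zero]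
  add_mem' := by
    rintro ⟨u₁, f₁⟩ ⟨u₂, f₂⟩ ⟨v₁, w₁, hs₁, hc₁, hv₁, hu₁, he₁⟩ ⟨v₂, w₂, hs₂, hc₂, hv₂, hu₂, he₂⟩
    simp only at hu₁ he₁ hu₂ he₂
    refine ⟨v₁ + v₂, fun x => w₁ x + w₂ x, ?_, hc₁.add hc₂, ?_, ?_, ?_⟩
    · have := hs₁.add hs₂
      rwa [← Lp.toTemperedDistributionCLM_apply, ← Lp.toTemperedDistributionCLM_apply,
        ← map_add] at this
    · filter_upwards [Lp.coeFn_add v₁ v₂, hv₁, hv₂] with x h h₁ h₂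
      rw [h, Pi.add_apply, h₁, h₂]
    · filter_upwards [Lp.coeFn_add u₁ u₂, hu₁, hu₂] with x h h₁ h₂
      simp only [Prod.mk_add_mk, h, Pi.add_apply, h₁, h₂, domainFunction, mul_add, add_mul,
        Finset.sum_add_distrib]
      ring
    · have e : ((f₁, u₁) + (f₂, u₂) : L2Plane × L2Plane).1 - z ^ 2 • (u₁ + u₂)
          = (f₁ - z ^ 2 • u₁) + (f₂ - z ^ 2 • u₂) := by
        simp only [Prod.mk_add_mk, smul_add]; abel
      simp only [Prod.mk_add_mk] at e ⊢
      rw [e]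
      simp only [← Lp.toTemperedDistributionCLM_apply, ← TemperedDistribution.laplacianCLM_apply,
        map_add, smul_add] at he₁ he₂ ⊢
      rw [he₁, he₂]
      abel
  smul_mem' := by
    rintro c ⟨u, f⟩ ⟨v, w, hs, hc, hv, hu, he⟩
    simp only at hu he
    refine ⟨c • v, fun x => c * w x, ?_, continuous_const.mul hc, ?_, ?_, ?_⟩
    · have := hs.smul c
      rwa [← Lp.toTemperedDistributionCLM_apply, ← map_smul] at this
    · filter_upwards [Lp.coeFn_smul c v, hv] with x h h₁
      simp [h, h₁]
    · filter_upwards [Lp.coeFn_smul c u, hu] with x h h₁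
      simp only [Prod.smul_mk, h, Pi.smul_apply, h₁, domainFunction, smul_eq_mul, mul_add,
        Finset.mul_sum]
      congr 1
      refine Finset.sum_congr rfl fun j _ => Finset.sum_congr rfl fun k _ => ?_
      ring
    · have e : c • f - z ^ 2 • c • u = c • (f - z ^ 2 • u) := by
        rw [smul_sub, smul_comm]
      simp only [Prod.smul_mk]
      rw [e]
      simp only [← Lp.toTemperedDistributionCLM_apply, ← TemperedDistribution.laplacianCLM_apply,
        map_smul] at he ⊢
      rw [he, smul_sub, smul_neg, smul_comm]

/-- The self-adjoint operator `H_{α,Y}`, as an unbounded operator in `L²(ℝ²)`: for every `z` in the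
open upper half-plane with `Γ_{α,Y}(z)` invertible, its graph is the one described at `z`. (These
descriptions all give the same operator, so that the intersection is each of them.) -/
def pointInteraction (α : Fin N → ℝ) (y : Fin N → Plane) : L2Plane →ₗ.[ℂ] L2Plane :=
  (⨅ z ∈ admissible α y, pointInteractionGraphAt α y z).toLinearPMap

/-- The real symmetric matrix `𝒟̃`, with diagonal entries `α_j` and off-diagonal entries
`(2π)⁻¹ log |y_j - y_k|`. -/
def dMatrix (α : Fin N → ℝ) (y : Fin N → Plane) : Matrix (Fin N) (Fin N) ℝ :=
  Matrix.of fun j k => if j = k then α j else 1 / (2 * Real.pi) * Real.log ‖y j - y k‖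

/-- The function `-∑_j a_j (2π)⁻¹ log |x - y_j|`. -/
def logPotential (y : Fin N → Plane) (a : Fin N → ℂ) (x : Plane) : ℂ :=
  -∑ j, a j / (2 * (Real.pi : ℂ)) * ((Real.log ‖x - y j‖ : ℝ) : ℂ)

end

/-!
Removing the logarithms from `u = v + ∑_j q_j 𝒢_z(· - y_j)` leaves the continuous function
`w = u + ∑_j q_j (2π)⁻¹ log |· - y_j|`, and since `-(2π)⁻¹ log |x| - 𝒢_z(x)` tends at the origin to
the constant in the diagonal of `Γ_{α,Y}(z)`, the condition `Γ_{α,Y}(z) q = (v(y_k))_k` becomes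
`w(y_k) = (𝒟̃ q)_k`. So the graph of `H_{α,Y}` has a description free of `z`: in Fourier variables,
with `-Δ` acting as `4π²|ξ|²`, it says that `𝓕 f = 4π²|ξ|² 𝓕 u - ∑_j q_j exp (-2πi ⟨y_j, ξ⟩)`.

If `f = 0`, then `𝓕 u` is the exponential sum divided by `4π²|ξ|²`. In two dimensions this is square
integrable at the origin only if the Taylor expansion of the sum starts at order two, that is
`∑_j q_j = 0` and `∑_j q_j y_j = 0`; then `u` is the limit in `L²` of `∑_j q_j 𝒢_{iκ}(· - y_j)` as
`κ → 0`, which is the logarithmic potential of `q`. Hence `w = 0`, and `𝒟̃ q = 0`.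
-/

noncomputable section

open Filter Set Topology FourierTransform ContDiff

/-! ### The exponential integral -/

/-- The exponential integral `E₁(w) = ∫₁^∞ exp (-w u) u⁻¹ du` on the open right half-plane, in the
variable `u = exp t`. -/
def expIntegral (w : ℂ) : ℂ := ∫ t in Ioi (0 : ℝ), Complex.exp (-w * (Real.exp t : ℝ))

theorem norm_cexp_neg_mul_ofReal (w : ℂ) (x : ℝ) :
    ‖Complex.exp (-w * (x : ℂ))‖ = Real.exp (-(w.re * x)) := by
  rw [Complex.norm_exp, Complex.re_mul_ofReal, Complex.neg_re, neg_mul]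

theorem integrableOn_cexp_neg_mul_exp {w : ℂ} (hw : 0 < w.re) :
    IntegrableOn (fun t : ℝ => Complex.exp (-w * (Real.exp t : ℝ))) (Ioi 0) := by
  refine (integrableOn_exp_mul_Ioi (neg_lt_zero.2 hw) 0).mono'
    (by fun_prop : Continuous _).aestronglyMeasurable (ae_of_all _ fun t => ?_)
  rw [norm_cexp_neg_mul_ofReal, neg_mul]
  gcongr
  linarith [Real.add_one_le_exp t]

theorem hasDerivAt_expIntegral {w : ℂ} (hw : 0 < w.re) :
    HasDerivAt expIntegral (-Complex.exp (-w) / w) w := by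
  have integral_deriv : ∫ t in Ioi (0 : ℝ), Complex.exp (-w * (Real.exp t : ℝ)) * -(Real.exp t : ℝ)
      = -Complex.exp (-w) / w := by
    have h := integral_comp_exp_Ioi (fun u : ℝ => -Complex.exp (-w * u)) 0
    rw [Real.exp_zero, integral_neg, integral_exp_mul_complex_Ioi (by simpa using hw)] at h
    simpa [mul_comm, neg_div, div_neg] using h
  have integrable_bound :
      IntegrableOn (fun t => Real.exp t * Real.exp (-(w.re / 2) * Real.exp t)) (Ioi 0) :=
    (integrableOn_comp_exp_Ioi (fun u => Real.exp (-(w.re / 2) * u)) 0).2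
      (integrableOn_exp_mul_Ioi (by linarith) _)
  rw [← integral_deriv]
  refine (hasDerivAt_integral_of_dominated_loc_of_deriv_le
    (F := fun (v : ℂ) (t : ℝ) => Complex.exp (-v * (Real.exp t : ℝ)))
    (F' := fun (v : ℂ) (t : ℝ) => Complex.exp (-v * (Real.exp t : ℝ)) * -(Real.exp t : ℝ))
    (Complex.continuous_re.continuousAt.eventually_mem (Ioi_mem_nhds (half_lt_self hw)))
    (Eventually.of_forall fun v => by fun_prop) (integrableOn_cexp_neg_mul_exp hw)
    (by fun_prop)
    (ae_of_all _ fun t v hv => ?_) integrable_bound (ae_of_all _ fun t v _ => ?_)).2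
  · have hv : w.re / 2 ≤ v.re := le_of_lt hv
    rw [norm_mul, norm_cexp_neg_mul_ofReal, norm_neg, Complex.norm_of_nonneg (Real.exp_pos t).le,
      mul_comm, neg_mul]
    gcongr
  · simpa using ((hasDerivAt_id v).neg.mul_const ((Real.exp t : ℝ) : ℂ)).cexp

theorem integral_log_mul_exp_neg :
    ∫ u in Ioi (0 : ℝ), Real.log u * Real.exp (-u) = -Real.eulerMascheroniConstant := by
  have eventually_eq : Complex.Gamma =ᶠ[𝓝 1] Complex.GammaIntegral := by
    filter_upwards [Complex.continuous_re.continuousAt.eventually_mem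
      (Ioi_mem_nhds (by simp : (0 : ℝ) < (1 : ℂ).re))] with s hs
    exact Complex.Gamma_eq_integral hs
  have h := ((Complex.hasDerivAt_GammaIntegral (s := 1) (by simp)).congr_of_eventuallyEq
    eventually_eq).unique Complex.hasDerivAt_Gamma_one
  simp only [sub_self, Complex.cpow_zero, one_mul] at h
  rw [← Complex.ofReal_inj, ← integral_complex_ofReal]
  simpa using h

theorem integrableOn_log_mul_exp_neg :
    IntegrableOn (fun u : ℝ => Real.log u * Real.exp (-u)) (Ioi 0) := by
  refine Integrable.of_integral_ne_zero ?_
  rw [integral_log_mul_exp_neg]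
  linarith [Real.one_half_lt_eulerMascheroniConstant]

theorem tendsto_log_mul_exp_neg_atTop :
    Tendsto (fun u : ℝ => Real.log u * Real.exp (-u)) atTop (𝓝 0) := by
  have h : (fun u : ℝ => Real.exp (-u)) =O[atTop] fun u => u ^ (-1 : ℝ) := by
    simpa using (isLittleO_exp_neg_mul_rpow_atTop one_pos (-1)).isBigO
  refine (Asymptotics.isLittleO_one_iff ℝ).1
    (((isLittleO_log_rpow_atTop one_pos).mul_isBigO h).congr' EventuallyEq.rfl ?_)
  filter_upwards [eventually_gt_atTop 0] with u hu
  rw [← Real.rpow_add hu, add_neg_cancel, Real.rpow_zero]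

theorem integral_exp_neg_div_Ioi {r : ℝ} (hr : 0 < r) :
    ∫ u in Ioi r, Real.exp (-u) / u
      = (∫ u in Ioi r, Real.log u * Real.exp (-u)) - Real.log r * Real.exp (-r) := by
  have integrable_div : IntegrableOn (fun u => Real.exp (-u) / u) (Ioi r) := by
    refine ((integrableOn_exp_neg_Ioi r).div_const r).mono'
      (by fun_prop : Measurable _).aestronglyMeasurable
      ((ae_restrict_mem measurableSet_Ioi).mono fun u (hu : r < u) => ?_)
    have : 0 < u := hr.trans hu
    rw [Real.norm_of_nonneg (by positivity)]
    gcongr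
  have integrable_log := integrableOn_log_mul_exp_neg.mono_set (Ioi_subset_Ioi hr.le)
  have parts := integral_Ioi_of_hasDerivAt_of_tendsto' (a := r) (fun u (hu : r ≤ u) =>
    ((Real.hasDerivAt_log (hr.trans_le hu).ne').mul (hasDerivAt_neg u).exp).congr_deriv
      (by ring : _ = Real.exp (-u) / u - Real.log u * Real.exp (-u)))
    (integrable_div.sub integrable_log) tendsto_log_mul_exp_neg_atTop
  rw [integral_sub integrable_div integrable_log] at parts
  simp only [Pi.mul_apply] at parts
  linarith

theorem expIntegral_ofReal {r : ℝ} (hr : 0 < r) :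
    expIntegral r = ((∫ u in Ioi r, Real.exp (-u) / u : ℝ) : ℂ) := by
  have h : ∫ t in Ioi (0 : ℝ), Real.exp (-(r * Real.exp t)) = ∫ u in Ioi r, Real.exp (-u) / u :=
    calc
      _ = ∫ t in Ioi (0 : ℝ), Real.exp t • ((Real.exp t)⁻¹ * Real.exp (-(r * Real.exp t))) := by
        simp only [smul_eq_mul, mul_inv_cancel_left₀ (Real.exp_pos _).ne']
      _ = ∫ u in Ioi 1, u⁻¹ * Real.exp (-(r * u)) := by
        rw [integral_comp_exp_Ioi (fun u => u⁻¹ * Real.exp (-(r * u))), Real.exp_zero]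
      _ = ∫ u in Ioi 1, r * (Real.exp (-(r * u)) / (r * u)) := by
        congr with u
        field_simp
      _ = _ := by
        rw [integral_const_mul, ← smul_eq_mul,
          integral_comp_mul_left_Ioi' (fun u => Real.exp (-u) / u) 1 hr, mul_one]
  rw [← h, ← integral_complex_ofReal, expIntegral]
  simp

theorem tendsto_log_mul_one_sub_exp_neg :
    Tendsto (fun r : ℝ => Real.log r * (1 - Real.exp (-r))) (𝓝[>] 0) (𝓝 0) := by
  have h : Tendsto (fun r : ℝ => ‖r * Real.log r‖) (𝓝[>] 0) (𝓝 0) :=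
    (Real.continuous_mul_log.norm.tendsto' 0 0 (by simp)).mono_left nhdsWithin_le_nhds
  refine squeeze_zero_norm' ?_ h
  filter_upwards [self_mem_nhdsWithin] with r (hr : 0 < r)
  have : Real.exp (-r) ≤ 1 := Real.exp_le_one_iff.2 (by linarith)
  rw [norm_mul, norm_mul, mul_comm, Real.norm_of_nonneg hr.le,
    Real.norm_of_nonneg (by linarith : 0 ≤ 1 - Real.exp (-r))]
  gcongr
  linarith [Real.add_one_le_exp (-r)]

theorem tendsto_expIntegral_ofReal_add_log :
    Tendsto (fun r : ℝ => expIntegral r + Complex.log r) (𝓝[>] 0)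
      (𝓝 (-Real.eulerMascheroniConstant)) := by
  have tendsto_integral : Tendsto (fun r => ∫ u in Ioi r, Real.log u * Real.exp (-u)) (𝓝[>] 0)
      (𝓝 (-Real.eulerMascheroniConstant)) := by
    rw [← integral_log_mul_exp_neg]
    have cover := aecover_Ioi_of_Ioi (μ := volume) (l := 𝓝[>] (0 : ℝ)) (a := id)
      (tendsto_id.mono_left nhdsWithin_le_nhds)
    refine (cover.integral_tendsto_of_countably_generated integrableOn_log_mul_exp_neg).congr' ?_
    filter_upwards [self_mem_nhdsWithin] with r (hr : 0 < r)
    rw [Measure.restrict_restrict measurableSet_Ioi, id, inter_eq_left.2 (Ioi_subset_Ioi hr.le)]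
  have h := (tendsto_log_mul_one_sub_exp_neg.add tendsto_integral).ofReal
  rw [zero_add, Complex.ofReal_neg] at h
  refine h.congr' ?_
  filter_upwards [self_mem_nhdsWithin] with r (hr : 0 < r)
  rw [expIntegral_ofReal hr, integral_exp_neg_div_Ioi hr, ← Complex.ofReal_log hr.le]
  push_cast
  ring

theorem tendsto_expIntegral_mul_sub {η : ℂ} (hη : 0 < η.re) :
    Tendsto (fun r : ℝ => (expIntegral (η * r) + Complex.log (η * r))
      - (expIntegral r + Complex.log r)) (𝓝[>] 0) (𝓝 0) := by
  have lipschitz : ∀ v ∈ {w : ℂ | 0 < w.re} ∩ Metric.closedBall 0 1,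
      ∀ w ∈ {w : ℂ | 0 < w.re} ∩ Metric.closedBall 0 1,
      ‖(expIntegral w + Complex.log w) - (expIntegral v + Complex.log v)‖ ≤ 2 * ‖w - v‖ := by
    intro v hv w hw
    refine Convex.norm_image_sub_le_of_norm_hasDerivWithin_le (𝕜 := ℂ)
      (f' := fun w => -Complex.exp (-w) / w + w⁻¹) (fun u hu => ((hasDerivAt_expIntegral hu.1).add
        (Complex.hasDerivAt_log (Or.inl hu.1))).hasDerivWithinAt) (fun u hu => ?_)
      ((convex_halfSpace_re_gt 0).inter (convex_closedBall 0 1)) hv hw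
    have hu0 : u ≠ 0 := fun h => by simpa [h] using hu.1
    have := Complex.norm_exp_sub_one_le (x := -u) (by simpa using hu.2)
    rw [norm_neg] at this
    rw [show -Complex.exp (-u) / u + u⁻¹ = -(Complex.exp (-u) - 1) / u by ring, norm_div, norm_neg,
      div_le_iff₀ (norm_pos_iff.2 hu0)]
    exact this
  have small : ∀ w : ℂ, 0 < w.re →
      ∀ᶠ r : ℝ in 𝓝[>] 0, w * r ∈ {w : ℂ | 0 < w.re} ∩ Metric.closedBall 0 1 := by
    intro w hw
    have : Tendsto (fun r : ℝ => w * r) (𝓝[>] 0) (𝓝 0) :=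
      ((by fun_prop : Continuous fun r : ℝ => w * r).tendsto' 0 0 (by simp)).mono_left
        nhdsWithin_le_nhds
    filter_upwards [this.eventually_mem (Metric.closedBall_mem_nhds 0 one_pos),
      self_mem_nhdsWithin] with r hr (hr0 : 0 < r)
    exact ⟨by simpa using mul_pos hw hr0, hr⟩
  have bound : Tendsto (fun r : ℝ => 2 * ‖η * r - r‖) (𝓝[>] 0) (𝓝 0) :=
    ((by fun_prop : Continuous fun r : ℝ => 2 * ‖η * r - r‖).tendsto' 0 0 (by simp)).mono_left
      nhdsWithin_le_nhds
  refine squeeze_zero_norm' ?_ bound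
  filter_upwards [small η hη, small 1 (by simp)] with r hr hr'
  exact lipschitz r (by simpa using hr') _ hr

theorem tendsto_expIntegral_add_log {η : ℂ} (hη : 0 < η.re) :
    Tendsto (fun r : ℝ => expIntegral (η * r) + Real.log r) (𝓝[>] 0)
      (𝓝 (-Complex.log η - Real.eulerMascheroniConstant)) := by
  have h := ((tendsto_expIntegral_mul_sub hη).add tendsto_expIntegral_ofReal_add_log).sub_const
    (Complex.log η)
  rw [zero_add, neg_sub_comm] at h
  refine h.congr' ?_
  filter_upwards [self_mem_nhdsWithin] with r (hr : 0 < r)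
  rw [Complex.log_mul_ofReal r hr η (by rintro rfl; simp at hη), Complex.ofReal_log hr.le]
  ring

/-! ### The modified Bessel function and the Green kernel -/

/-- The modified Bessel function `K₀` on the open right half-plane. -/
def besselK (s : ℂ) : ℂ := ∫ t in Ioi (0 : ℝ), Complex.exp (-s * (Real.cosh t : ℝ))

theorem exp_neg_le_one_div_sqrt {x : ℝ} (hx : 0 < x) : Real.exp (-x) ≤ 1 / √x := by
  rw [Real.exp_neg, ← one_div]
  refine one_div_le_one_div_of_le (Real.sqrt_pos.2 hx) ?_
  rw [Real.sqrt_le_left (Real.exp_pos x).le, ← Real.exp_nat_mul]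
  push_cast
  linarith [Real.add_one_le_exp (2 * x)]

theorem exp_neg_mul_cosh_le {σ : ℝ} (hσ : 0 < σ) (t : ℝ) :
    Real.exp (-(σ * Real.cosh t)) ≤ 2 * Real.exp (-σ / 2) / √σ * Real.exp (-t / 2) := by
  have exp_le_cosh : Real.exp t / 2 ≤ Real.cosh t := by
    rw [Real.cosh_eq]; linarith [Real.exp_pos (-t)]
  have sqrt_eq : √(σ * Real.exp t / 4) = √σ * Real.exp (t / 2) / 2 := by
    rw [show σ * Real.exp t / 4 = σ * (Real.exp (t / 2) / 2) ^ 2 by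
      rw [div_pow, ← Real.exp_nat_mul]; push_cast; ring_nf, Real.sqrt_mul hσ.le,
      Real.sqrt_sq (by positivity), mul_div_assoc]
  calc Real.exp (-(σ * Real.cosh t)) ≤ Real.exp (-σ / 2 + -(σ * Real.exp t / 4)) := by
        gcongr
        nlinarith [Real.one_le_cosh t]
    _ = Real.exp (-σ / 2) * Real.exp (-(σ * Real.exp t / 4)) := Real.exp_add _ _
    _ ≤ Real.exp (-σ / 2) * (1 / √(σ * Real.exp t / 4)) := by
        gcongr
        exact exp_neg_le_one_div_sqrt (by positivity)
    _ = 2 * Real.exp (-σ / 2) / √σ * Real.exp (-t / 2) := by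
        rw [sqrt_eq, neg_div 2 t, Real.exp_neg (t / 2)]
        field_simp

theorem exp_neg_div_two_eq (t : ℝ) : Real.exp (-t / 2) = Real.exp (-(1 / 2) * t) := by ring_nf

theorem integrableOn_exp_neg_div_two : IntegrableOn (fun t : ℝ => Real.exp (-t / 2)) (Ioi 0) := by
  simpa only [exp_neg_div_two_eq] using integrableOn_exp_mul_Ioi (a := -(1 / 2)) (by norm_num) 0

theorem integral_exp_neg_div_two : ∫ t in Ioi (0 : ℝ), Real.exp (-t / 2) = 2 := by
  simp only [exp_neg_div_two_eq]
  rw [integral_exp_mul_Ioi (by norm_num)]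
  norm_num

theorem norm_cexp_neg_mul_cosh_le {s : ℂ} (hs : 0 < s.re) (t : ℝ) :
    ‖Complex.exp (-s * (Real.cosh t : ℝ))‖
      ≤ 2 * Real.exp (-s.re / 2) / √s.re * Real.exp (-t / 2) := by
  rw [norm_cexp_neg_mul_ofReal]
  exact exp_neg_mul_cosh_le hs t

theorem continuous_cexp_neg_mul_cosh (s : ℂ) :
    Continuous fun t : ℝ => Complex.exp (-s * (Real.cosh t : ℝ)) := by
  have := Real.continuous_cosh
  fun_prop

theorem integrableOn_cexp_neg_mul_cosh {s : ℂ} (hs : 0 < s.re) :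
    IntegrableOn (fun t : ℝ => Complex.exp (-s * (Real.cosh t : ℝ))) (Ioi 0) :=
  (integrableOn_exp_neg_div_two.const_mul _).mono'
    (continuous_cexp_neg_mul_cosh s).aestronglyMeasurable
    (ae_of_all _ (norm_cexp_neg_mul_cosh_le hs))

theorem norm_besselK_le {s : ℂ} (hs : 0 < s.re) :
    ‖besselK s‖ ≤ 4 * Real.exp (-s.re / 2) / √s.re := by
  refine (norm_integral_le_of_norm_le (integrableOn_exp_neg_div_two.const_mul _)
    (ae_of_all _ (norm_cexp_neg_mul_cosh_le hs))).trans_eq ?_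
  rw [integral_const_mul, integral_exp_neg_div_two]
  ring

theorem continuousAt_besselK {s : ℂ} (hs : 0 < s.re) : ContinuousAt besselK s := by
  refine continuousAt_of_dominated
    (Eventually.of_forall fun w => (continuous_cexp_neg_mul_cosh w).aestronglyMeasurable)
    ?_ (integrableOn_exp_neg_div_two.const_mul (2 / √(s.re / 2))) (ae_of_all _ fun t => by fun_prop)
  filter_upwards [Complex.continuous_re.continuousAt.eventually_mem
    (Ioi_mem_nhds (half_lt_self hs))] with w (hw : s.re / 2 < w.re)
  have hw0 : 0 < w.re := by linarith
  refine ae_of_all _ fun t => (norm_cexp_neg_mul_cosh_le hw0 t).trans ?_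
  have : Real.exp (-w.re / 2) ≤ 1 := Real.exp_le_one_iff.2 (by linarith)
  gcongr
  linarith

theorem norm_cexp_cosh_sub_cexp_exp_le {s : ℂ} (hs : 0 < s.re) (hs2 : ‖s / 2‖ ≤ 1) {t : ℝ}
    (ht : 0 < t) :
    ‖Complex.exp (-s * (Real.cosh t : ℝ)) - Complex.exp (-(s / 2) * (Real.exp t : ℝ))‖
      ≤ ‖s‖ * Real.exp (-t) := by
  have factor : Complex.exp (-s * (Real.cosh t : ℝ)) - Complex.exp (-(s / 2) * (Real.exp t : ℝ))
      = Complex.exp (-(s / 2) * (Real.exp t : ℝ))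
        * (Complex.exp (-(s / 2) * (Real.exp (-t) : ℝ)) - 1) := by
    rw [mul_sub_one, ← Complex.exp_add, ← mul_add, ← Complex.ofReal_add, Real.cosh_eq]
    push_cast
    ring_nf
  have norm_le_one : ‖Complex.exp (-(s / 2) * (Real.exp t : ℝ))‖ ≤ 1 := by
    rw [norm_cexp_neg_mul_ofReal, Real.exp_le_one_iff, Complex.div_ofNat_re]
    have := Real.exp_pos t
    nlinarith
  have norm_exponent : ‖-(s / 2) * (Real.exp (-t) : ℝ)‖ = ‖s / 2‖ * Real.exp (-t) := by
    rw [norm_mul, norm_neg, Complex.norm_of_nonneg (Real.exp_pos _).le]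
  have norm_sub_one := Complex.norm_exp_sub_one_le (x := -(s / 2) * (Real.exp (-t) : ℝ)) <| by
    rw [norm_exponent]
    exact mul_le_one₀ hs2 (Real.exp_pos _).le (Real.exp_le_one_iff.2 (by linarith))
  rw [factor, norm_mul]
  refine (mul_le_of_le_one_left (norm_nonneg _) norm_le_one).trans (norm_sub_one.trans_eq ?_)
  rw [norm_exponent, norm_div, Complex.norm_two]
  ring

theorem norm_besselK_sub_expIntegral_le {s : ℂ} (hs : 0 < s.re) (hs2 : ‖s / 2‖ ≤ 1) :
    ‖besselK s - expIntegral (s / 2)‖ ≤ ‖s‖ := by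
  have hs' : 0 < (s / 2).re := by rw [Complex.div_ofNat_re]; linarith
  rw [besselK, expIntegral, ← integral_sub (integrableOn_cexp_neg_mul_cosh hs)
    (integrableOn_cexp_neg_mul_exp hs')]
  refine (norm_integral_le_of_norm_le ((integrableOn_exp_neg_Ioi 0).const_mul ‖s‖)
    ((ae_restrict_mem measurableSet_Ioi).mono fun t ht =>
      norm_cexp_cosh_sub_cexp_exp_le hs hs2 ht)).trans_eq ?_
  rw [integral_const_mul, integral_exp_neg_Ioi_zero, mul_one]

theorem mul_ofReal_re_pos {ζ : ℂ} (hζ : 0 < ζ.re) {r : ℝ} (hr : 0 < r) : 0 < (ζ * r).re := by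
  rw [Complex.re_mul_ofReal]
  positivity

theorem tendsto_besselK_add_log {ζ : ℂ} (hζ : 0 < ζ.re) :
    Tendsto (fun r : ℝ => besselK (ζ * r) + Real.log r) (𝓝[>] 0)
      (𝓝 (-Complex.log (ζ / 2) - Real.eulerMascheroniConstant)) := by
  have hζ2 : 0 < (ζ / 2).re := by rw [Complex.div_ofNat_re]; linarith
  have norm_tendsto {w : ℂ} : Tendsto (fun r : ℝ => ‖w * r‖) (𝓝[>] 0) (𝓝 0) :=
    ((by fun_prop : Continuous fun r : ℝ => ‖w * r‖).tendsto' 0 0 (by simp)).mono_left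
      nhdsWithin_le_nhds
  have sub_tendsto : Tendsto (fun r : ℝ => besselK (ζ * r) - expIntegral (ζ / 2 * r)) (𝓝[>] 0)
      (𝓝 0) := by
    refine squeeze_zero_norm' ?_ (norm_tendsto (w := ζ))
    filter_upwards [norm_tendsto.eventually_le_const one_pos, self_mem_nhdsWithin]
      with r hr (hr0 : 0 < r)
    rw [div_mul_eq_mul_div] at hr ⊢
    exact norm_besselK_sub_expIntegral_le (mul_ofReal_re_pos hζ hr0) hr
  have h := sub_tendsto.add (tendsto_expIntegral_add_log hζ2)
  simpa only [← add_assoc, sub_add_cancel, zero_add] using h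

theorem integral_eq_two_nsmul_of_even {E : Type*} [NormedAddCommGroup E] [NormedSpace ℝ E]
    {f : ℝ → E} (hf : Function.Even f) (hfi : IntegrableOn f (Ioi 0)) :
    ∫ t, f t = 2 • ∫ t in Ioi (0 : ℝ), f t := by
  have hfi' : IntegrableOn f (Iic 0) := by
    rw [integrableOn_Iic_iff_integrableOn_Iio]
    rw [← neg_zero] at hfi
    simpa only [hf _] using hfi.comp_neg_Iio
  have hneg : ∫ t in Iic (0 : ℝ), f t = ∫ t in Ioi (0 : ℝ), f t := by
    simpa only [hf _, neg_zero] using integral_comp_neg_Iic 0 f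
  rw [← intervalIntegral.integral_Iic_add_Ioi hfi' hfi, hneg, two_nsmul]

theorem integral_comp_mul_exp {E : Type*} [NormedAddCommGroup E] [NormedSpace ℝ E] (f : ℝ → E)
    {r : ℝ} (hr : 0 < r) :
    ∫ t, (r * Real.exp t) • f (r * Real.exp t) = ∫ u in Ioi 0, f u := by
  have image : (fun t => r * Real.exp t) '' univ = Ioi 0 := by
    rw [← image_image (r * ·), image_univ, Real.range_exp, image_mul_left_Ioi hr, mul_zero]
  have h := integral_image_eq_integral_abs_deriv_smul MeasurableSet.univ
    (fun t _ => ((Real.hasDerivAt_exp t).const_mul r).hasDerivWithinAt)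
    (fun s _ t _ hst => Real.exp_injective (mul_left_cancel₀ hr.ne' hst)) f
  rw [image, setIntegral_univ] at h
  rw [h]
  congr with t
  rw [abs_of_pos (by positivity)]

theorem besselK_eq_integral_heat {ζ : ℂ} (hζ : 0 < ζ.re) {r : ℝ} (hr : 0 < r) :
    besselK (ζ * r) = 1 / 2 * ∫ τ in Ioi (0 : ℝ),
      Complex.exp (-ζ * τ) * Complex.exp (-(ζ / (4 * τ)) * (r : ℂ) ^ 2) / τ := by
  have even : Function.Even fun t : ℝ => Complex.exp (-(ζ * r) * (Real.cosh t : ℝ)) := fun t => by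
    simp only [Real.cosh_neg]
  have h := integral_eq_two_nsmul_of_even even
    (integrableOn_cexp_neg_mul_cosh (mul_ofReal_re_pos hζ hr))
  rw [← besselK, two_nsmul, ← two_mul] at h
  rw [← integral_comp_mul_exp _ (half_pos hr), one_div, ← inv_mul_cancel_left₀ two_ne_zero
    (besselK _), ← h]
  congr with t
  have hr0 : (r : ℂ) ≠ 0 := by exact_mod_cast hr.ne'
  have hexp : Complex.exp t ≠ 0 := Complex.exp_ne_zero t
  rw [Complex.real_smul, mul_div_cancel₀ _ (by exact_mod_cast (by positivity)), ← Complex.exp_add,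
    Real.cosh_eq]
  push_cast
  rw [Complex.exp_neg]
  congr 1
  field_simp
  ring

theorem greenKernel_eq_besselK (z : ℂ) (x : Plane) :
    greenKernel z x = 1 / (2 * Real.pi) * besselK (-Complex.I * z * (‖x‖ : ℝ)) := by
  have hI := Complex.I_ne_zero
  have hpi : (Real.pi : ℂ) ≠ 0 := by exact_mod_cast Real.pi_ne_zero
  have h (t : ℝ) : Complex.I * (z * (‖x‖ : ℝ)) * (Real.cosh t : ℝ)
      = -(-Complex.I * z * (‖x‖ : ℝ)) * (Real.cosh t : ℝ) := by ring
  simp only [greenKernel, hankelZero, besselK, h]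
  field_simp
  ring

theorem re_neg_I_mul (z : ℂ) : (-Complex.I * z).re = z.im := by simp

theorem continuousAt_greenKernel {z : ℂ} (hz : 0 < z.im) {x : Plane} (hx : x ≠ 0) :
    ContinuousAt (greenKernel z) x := by
  have h : 0 < (-Complex.I * z * (‖x‖ : ℝ)).re :=
    mul_ofReal_re_pos (by rwa [re_neg_I_mul]) (norm_pos_iff.2 hx)
  have hc : ContinuousAt (fun x : Plane => -Complex.I * z * (‖x‖ : ℝ)) x := by fun_prop
  rw [funext (greenKernel_eq_besselK z)]
  exact (ContinuousAt.comp (f := fun x : Plane => -Complex.I * z * (‖x‖ : ℝ))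
    (continuousAt_besselK h) hc).const_mul _

theorem aestronglyMeasurable_greenKernel {z : ℂ} (hz : 0 < z.im) :
    AEStronglyMeasurable (greenKernel z) volume := by
  rw [← restrict_compl_singleton (μ := volume) (0 : Plane)]
  exact ContinuousOn.aestronglyMeasurable
    (fun x hx => (continuousAt_greenKernel hz hx).continuousWithinAt)
    (measurableSet_singleton _).compl

theorem norm_greenKernel_le {z : ℂ} (hz : 0 < z.im) {x : Plane} (hx : x ≠ 0) :
    ‖greenKernel z x‖ ≤ Real.exp (-(z.im * ‖x‖) / 2) / √(z.im * ‖x‖) := by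
  have hre : (-Complex.I * z * (‖x‖ : ℝ)).re = z.im * ‖x‖ := by
    rw [Complex.re_mul_ofReal, re_neg_I_mul]
  have hpos : 0 < z.im * ‖x‖ := mul_pos hz (norm_pos_iff.2 hx)
  have hbessel := norm_besselK_le (hre ▸ hpos)
  have hpi : ‖1 / (2 * (Real.pi : ℂ))‖ ≤ 1 / 4 := by
    rw [norm_div, norm_mul, Complex.norm_of_nonneg Real.pi_pos.le, norm_one, Complex.norm_two]
    gcongr
    linarith [Real.two_le_pi]
  rw [hre] at hbessel
  calc ‖greenKernel z x‖ = ‖1 / (2 * (Real.pi : ℂ))‖ * ‖besselK (-Complex.I * z * (‖x‖ : ℝ))‖ := by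
        rw [greenKernel_eq_besselK, norm_mul]
    _ ≤ 1 / 4 * (4 * Real.exp (-(z.im * ‖x‖) / 2) / √(z.im * ‖x‖)) := by gcongr
    _ = _ := by ring

theorem finrank_plane : Module.finrank ℝ Plane = 2 := by simp

theorem ae_ne_zero_plane : ∀ᵐ x : Plane, x ≠ 0 := by simp [ae_iff]

theorem integrable_comp_norm_plane_iff {f : ℝ → ℝ} :
    Integrable (fun x : Plane => f ‖x‖) ↔ IntegrableOn (fun r => r * f r) (Ioi 0) := by
  simpa using integrable_fun_norm_addHaar (volume : Measure Plane) (f := f)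

theorem integrable_greenKernel {z : ℂ} (hz : 0 < z.im) : Integrable (greenKernel z) := by
  have hbound : Integrable fun x : Plane => Real.exp (-(z.im * ‖x‖) / 2) / √(z.im * ‖x‖) := by
    refine (integrable_comp_norm_plane_iff
      (f := fun r => Real.exp (-(z.im * r) / 2) / √(z.im * r))).2 ?_
    refine ((integrableOn_rpow_mul_exp_neg_mul_rpow (s := 1 / 2) (p := 1) (b := z.im / 2)
      (by norm_num) one_pos (by linarith)).const_mul (1 / √z.im)).congr
      ((ae_restrict_mem measurableSet_Ioi).mono fun r (hr : 0 < r) => ?_)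
    simp only [Real.rpow_one, ← Real.sqrt_eq_rpow]
    have : 0 < √r := Real.sqrt_pos.2 hr
    rw [Real.sqrt_mul hz.le, show -(z.im * r) / 2 = -(z.im / 2) * r by ring]
    field_simp
    rw [Real.sq_sqrt hr.le]
  refine hbound.mono' (aestronglyMeasurable_greenKernel hz) ?_
  filter_upwards [ae_ne_zero_plane] with x hx
  exact norm_greenKernel_le hz hx

theorem memLp_two_greenKernel {z : ℂ} (hz : 0 < z.im) : MemLp (greenKernel z) 2 volume := by
  have hbound : Integrable fun x : Plane =>
      (Real.exp (-(z.im * ‖x‖) / 2) / √(z.im * ‖x‖)) ^ 2 := by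
    refine (integrable_comp_norm_plane_iff
      (f := fun r => (Real.exp (-(z.im * r) / 2) / √(z.im * r)) ^ 2)).2 ?_
    refine ((integrableOn_exp_mul_Ioi (neg_lt_zero.2 hz) 0).const_mul (1 / z.im)).congr
      ((ae_restrict_mem measurableSet_Ioi).mono fun r (hr : 0 < r) => ?_)
    have : 0 < z.im * r := mul_pos hz hr
    simp only
    rw [div_pow, Real.sq_sqrt this.le, ← Real.exp_nat_mul, Nat.cast_two,
      mul_div_cancel₀ _ two_ne_zero, neg_mul]
    field_simp
  rw [memLp_two_iff_integrable_sq_norm (aestronglyMeasurable_greenKernel hz)]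
  refine hbound.mono' ((aestronglyMeasurable_greenKernel hz).norm.pow 2) ?_
  filter_upwards [ae_ne_zero_plane] with x hx
  rw [Real.norm_of_nonneg (by positivity)]
  gcongr
  exact norm_greenKernel_le hz hx

/-! ### The Fourier transform of the Green kernel -/

/-- The symbol of `-Δ - z²`, for the Fourier transform with kernel `exp (-2πi ⟨x, ξ⟩)`. -/
def helmholtzSymbol {V : Type*} [Norm V] (z : ℂ) (ξ : V) : ℂ :=
  4 * (Real.pi : ℂ) ^ 2 * (‖ξ‖ : ℂ) ^ 2 - z ^ 2

theorem helmholtzSymbol_eq_mul {V : Type*} [Norm V] {z : ℂ} (hz : z ≠ 0) (ξ : V) :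
    helmholtzSymbol z ξ = -Complex.I * z
      * (-Complex.I * z + ((4 * Real.pi ^ 2 * ‖ξ‖ ^ 2 : ℝ) : ℂ) / (-Complex.I * z)) := by
  rw [mul_add, mul_div_cancel₀ _ (mul_ne_zero (neg_ne_zero.2 Complex.I_ne_zero) hz), ← sq, mul_pow,
    neg_sq, Complex.I_sq, helmholtzSymbol]
  push_cast
  ring

theorem re_add_ofReal_div_pos {ζ : ℂ} (hζ : 0 < ζ.re) {a : ℝ} (ha : 0 ≤ a) :
    0 < (ζ + a / ζ).re := by
  have h : 0 ≤ ((a : ℂ) / ζ).re := by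
    rw [div_eq_mul_inv, Complex.re_ofReal_mul, Complex.inv_re]
    have := Complex.normSq_nonneg ζ
    positivity
  rw [Complex.add_re]
  linarith

theorem ne_zero_of_re_pos {w : ℂ} (hw : 0 < w.re) : w ≠ 0 := by
  rintro rfl
  simp at hw

theorem helmholtzSymbol_ne_zero {V : Type*} [Norm V] {z : ℂ} (hz : 0 < z.im) (ξ : V) :
    helmholtzSymbol z ξ ≠ 0 := by
  have hζ : 0 < (-Complex.I * z).re := by rwa [re_neg_I_mul]
  rw [helmholtzSymbol_eq_mul (by rintro rfl; simp at hz)]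
  exact mul_ne_zero (ne_zero_of_re_pos hζ)
    (ne_zero_of_re_pos (re_add_ofReal_div_pos hζ (by positivity)))

/-- Up to a constant, the heat kernel of the plane at time `τ / ζ`, with the weight `exp (-ζ τ)`
that gives the kernel of the resolvent after integration in `τ`. -/
def heatProfile (ζ : ℂ) (τ : ℝ) (x : Plane) : ℂ :=
  Complex.exp (-ζ * τ) * Complex.exp (-(ζ / (4 * τ)) * (‖x‖ : ℂ) ^ 2) / τ

theorem greenKernel_eq_integral_heatProfile {z : ℂ} (hz : 0 < z.im) {x : Plane} (hx : x ≠ 0) :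
    greenKernel z x
      = 1 / (4 * Real.pi) * ∫ τ in Ioi (0 : ℝ), heatProfile (-Complex.I * z) τ x := by
  rw [greenKernel_eq_besselK,
    besselK_eq_integral_heat (by rwa [re_neg_I_mul]) (norm_pos_iff.2 hx)]
  simp only [heatProfile]
  ring

theorem norm_heatProfile (ζ : ℂ) {τ : ℝ} (hτ : 0 < τ) (x : Plane) :
    ‖heatProfile ζ τ x‖
      = Real.exp (-ζ.re * τ) / τ * Real.exp (-(ζ.re / (4 * τ)) * ‖x‖ ^ 2) := by
  have h : -(ζ / (4 * (τ : ℂ))) * (‖x‖ : ℂ) ^ 2 = -ζ * ((1 / (4 * τ) * ‖x‖ ^ 2 : ℝ) : ℂ) := by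
    push_cast
    ring
  rw [heatProfile, h, norm_div, norm_mul, norm_cexp_neg_mul_ofReal, norm_cexp_neg_mul_ofReal,
    Complex.norm_of_nonneg hτ.le]
  ring_nf

theorem integral_gaussian_plane {b : ℝ} (hb : 0 < b) :
    ∫ x : Plane, Real.exp (-b * ‖x‖ ^ 2) = Real.pi / b := by
  have h := GaussianFourier.integral_rexp_neg_mul_sq_norm (V := Plane) hb
  rwa [finrank_plane, Nat.cast_two, div_self two_ne_zero, Real.rpow_one] at h

theorem integrable_gaussian_plane {b : ℝ} (hb : 0 < b) :
    Integrable fun x : Plane => Real.exp (-b * ‖x‖ ^ 2) := by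
  refine Integrable.of_integral_ne_zero ?_
  rw [integral_gaussian_plane hb]
  positivity

theorem integrable_heatProfile {ζ : ℂ} (hζ : 0 < ζ.re) :
    Integrable (fun p : Plane × ℝ => heatProfile ζ p.2 p.1)
      (volume.prod (volume.restrict (Ioi 0))) := by
  have hmeas : Measurable fun p : Plane × ℝ => heatProfile ζ p.2 p.1 := by
    unfold heatProfile
    fun_prop
  rw [integrable_prod_iff' hmeas.aestronglyMeasurable]
  constructor
  · refine (ae_restrict_mem measurableSet_Ioi).mono fun τ (hτ : 0 < τ) => ?_
    have hslice : Measurable (heatProfile ζ τ) :=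
      Measurable.comp (f := fun x : Plane => (x, τ)) hmeas measurable_prodMk_right
    have hgauss := (integrable_gaussian_plane (b := ζ.re / (4 * τ)) (by positivity)).const_mul
      (Real.exp (-ζ.re * τ) / τ)
    have hbound (x : Plane) := (norm_heatProfile ζ hτ x).le
    exact hgauss.mono' hslice.aestronglyMeasurable (ae_of_all _ hbound)
  · refine ((integrableOn_exp_mul_Ioi (neg_lt_zero.2 hζ) 0).const_mul
      (4 * Real.pi / ζ.re)).congr
      ((ae_restrict_mem measurableSet_Ioi).mono fun τ (hτ : 0 < τ) => ?_)
    simp only [norm_heatProfile ζ hτ]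
    rw [integral_const_mul, integral_gaussian_plane (by positivity)]
    field_simp

theorem fourier_const_mul {V : Type*} [NormedAddCommGroup V] [InnerProductSpace ℝ V]
    [FiniteDimensional ℝ V] [MeasurableSpace V] [BorelSpace V] (c : ℂ) (f : V → ℂ) (ξ : V) :
    𝓕 (fun x => c * f x) ξ = c * 𝓕 f ξ := by
  simp only [Real.fourier_eq, Circle.smul_def, smul_eq_mul, mul_left_comm _ c, integral_const_mul]

theorem fourier_heatProfile {ζ : ℂ} (hζ : 0 < ζ.re) {τ : ℝ} (hτ : 0 < τ) (ξ : Plane) :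
    𝓕 (heatProfile ζ τ) ξ
      = 4 * Real.pi / ζ * Complex.exp (-(ζ + ((4 * Real.pi ^ 2 * ‖ξ‖ ^ 2 : ℝ) : ℂ) / ζ) * τ) := by
  have hζ0 := ne_zero_of_re_pos hζ
  have hτ0 : (τ : ℂ) ≠ 0 := by exact_mod_cast hτ.ne'
  have hpi : (Real.pi : ℂ) ≠ 0 := by exact_mod_cast Real.pi_ne_zero
  have hre : 0 < (ζ / (4 * (τ : ℂ))).re := by
    rw [show ζ / (4 * (τ : ℂ)) = ζ * ((1 / (4 * τ) : ℝ) : ℂ) by push_cast; ring]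
    exact mul_ofReal_re_pos hζ (by positivity)
  have gaussian := fourier_gaussian_innerProductSpace (V := Plane) hre ξ
  rw [finrank_plane, Nat.cast_two, div_self two_ne_zero, Complex.cpow_one] at gaussian
  have hprofile : heatProfile ζ τ = fun x => Complex.exp (-ζ * τ) / τ *
      Complex.exp (-(ζ / (4 * τ)) * (‖x‖ : ℂ) ^ 2) := by
    ext x
    rw [heatProfile]
    ring
  have exponent : -(Real.pi : ℂ) ^ 2 * (‖ξ‖ : ℂ) ^ 2 / (ζ / (4 * (τ : ℂ)))
      = -(((4 * Real.pi ^ 2 * ‖ξ‖ ^ 2 : ℝ) : ℂ) / ζ) * τ := by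
    push_cast
    field_simp
  rw [hprofile, fourier_const_mul, gaussian, exponent, neg_add, add_mul, Complex.exp_add]
  field_simp

theorem fourier_integral_eq_integral_fourier {V E T : Type*} [NormedAddCommGroup V]
    [InnerProductSpace ℝ V] [FiniteDimensional ℝ V] [MeasurableSpace V] [BorelSpace V]
    [NormedAddCommGroup E] [NormedSpace ℂ E] [MeasurableSpace T] {ν : Measure T} [SFinite ν]
    {f : V → T → E} (hf : Integrable (Function.uncurry f) (volume.prod ν)) (ξ : V) :
    𝓕 (fun x => ∫ t, f x t ∂ν) ξ = ∫ t, 𝓕 (fun x => f x t) ξ ∂ν := by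
  have hchar : Measurable fun p : V × T => (Real.fourierChar (-inner ℝ p.1 ξ) : ℂ) := by
    have := Real.continuous_fourierChar
    have : Continuous fun x : V => (Real.fourierChar (-inner ℝ x ξ) : ℂ) := by fun_prop
    exact this.measurable.comp measurable_fst
  simp only [Real.fourier_eq, Circle.smul_def, ← integral_smul]
  refine integral_integral_swap (hf.mono ?_ ?_)
  · exact hchar.aestronglyMeasurable.smul hf.aestronglyMeasurable
  · exact ae_of_all _ fun p => by simp [Function.uncurry, norm_smul, Circle.norm_coe]

theorem fourier_greenKernel {z : ℂ} (hz : 0 < z.im) (ξ : Plane) :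
    𝓕 (greenKernel z) ξ = 1 / helmholtzSymbol z ξ := by
  have hζ : 0 < (-Complex.I * z).re := by rwa [re_neg_I_mul]
  have hζ0 := ne_zero_of_re_pos hζ
  have hexp := re_add_ofReal_div_pos hζ (a := 4 * Real.pi ^ 2 * ‖ξ‖ ^ 2) (by positivity)
  have hexp0 := ne_zero_of_re_pos hexp
  rw [helmholtzSymbol_eq_mul (by rintro rfl; simp at hz)]
  set ζ := -Complex.I * z
  have hpi : (Real.pi : ℂ) ≠ 0 := by exact_mod_cast Real.pi_ne_zero
  calc 𝓕 (greenKernel z) ξ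
      = 𝓕 (fun x => 1 / (4 * Real.pi : ℂ) * ∫ τ in Ioi (0 : ℝ), heatProfile ζ τ x) ξ := by
        simp only [Real.fourier_eq]
        refine integral_congr_ae ?_
        filter_upwards [ae_ne_zero_plane] with x hx
        rw [greenKernel_eq_integral_heatProfile hz hx]
    _ = 1 / (4 * Real.pi) * ∫ τ in Ioi (0 : ℝ), 𝓕 (heatProfile ζ τ) ξ := by
        rw [fourier_const_mul,
          fourier_integral_eq_integral_fourier (integrable_heatProfile hζ)]
    _ = 1 / ζ * ∫ τ in Ioi (0 : ℝ),
          Complex.exp (-(ζ + ((4 * Real.pi ^ 2 * ‖ξ‖ ^ 2 : ℝ) : ℂ) / ζ) * τ) := by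
        rw [setIntegral_congr_fun measurableSet_Ioi fun τ hτ => fourier_heatProfile hζ hτ ξ,
          integral_const_mul]
        field_simp
    _ = 1 / (ζ * (ζ + ((4 * Real.pi ^ 2 * ‖ξ‖ ^ 2 : ℝ) : ℂ) / ζ)) := by
        rw [integral_exp_mul_complex_Ioi (by rwa [Complex.neg_re, neg_lt_zero]),
          Complex.ofReal_zero, mul_zero, Complex.exp_zero, neg_div_neg_eq, one_div_mul_one_div]

/-! ### The Fourier transform on `L²` and the Helmholtz equation -/

theorem helmholtzSymbol_eq_smul_sub {V : Type*} [Norm V] (z : ℂ) :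
    (helmholtzSymbol z : V → ℂ) = ((4 * Real.pi ^ 2 : ℝ) : ℂ) • (fun ξ : V => ((‖ξ‖ ^ 2 : ℝ) : ℂ))
      - fun _ => z ^ 2 := by
  ext ξ
  simp [helmholtzSymbol]

theorem hasTemperateGrowth_helmholtzSymbol {V : Type*} [NormedAddCommGroup V]
    [InnerProductSpace ℝ V] (z : ℂ) : (helmholtzSymbol z : V → ℂ).HasTemperateGrowth := by
  simp only [helmholtzSymbol_eq_smul_sub, Pi.smul_def, Pi.sub_def, smul_eq_mul]
  fun_prop

section Fourier

variable {V : Type*} [NormedAddCommGroup V] [InnerProductSpace ℝ V] [FiniteDimensional ℝ V]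
  [MeasurableSpace V] [BorelSpace V]

theorem ae_eq_of_integral_schwartz_mul_eq {f g : V → ℂ} (hf : LocallyIntegrable f)
    (hg : LocallyIntegrable g) (h : ∀ φ : 𝓢(V, ℂ), ∫ x, φ x * f x = ∫ x, φ x * g x) :
    f =ᵐ[volume] g := by
  refine ae_eq_of_integral_contDiff_smul_eq hf hg fun φ hφ hc => ?_
  have hc' : HasCompactSupport (Complex.ofRealCLM ∘ φ) := hc.comp_left rfl
  have hφ' : ContDiff ℝ ∞ (Complex.ofRealCLM ∘ φ) := by fun_prop
  simpa using h (hc'.toSchwartzMap hφ')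

theorem locallyIntegrable_coe_Lp_two (f : Lp ℂ 2 (volume : Measure V)) :
    LocallyIntegrable (f : V → ℂ) :=
  (Lp.memLp f).locallyIntegrable one_le_two

theorem toTemperedDistribution_apply_eq_integral (f : Lp ℂ 2 (volume : Measure V)) (φ : 𝓢(V, ℂ)) :
    (f : 𝓢'(V, ℂ)) φ = ∫ x, φ x * f x := by
  simp

theorem fourier_toLp_ae_eq {f : V → ℂ} (hf : Integrable f) (hf₂ : MemLp f 2) :
    (𝓕 (hf₂.toLp f) : Lp ℂ 2 (volume : Measure V)) =ᵐ[volume] 𝓕 f := by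
  have hcont : Continuous (𝓕 f) :=
    VectorFourier.fourierIntegral_continuous Real.continuous_fourierChar continuous_inner hf
  refine ae_eq_of_integral_schwartz_mul_eq (locallyIntegrable_coe_Lp_two _)
    hcont.locallyIntegrable fun φ => ?_
  have self_adjoint := VectorFourier.integral_fourierIntegral_smul_eq_flip (L := innerₗ V)
    (μ := volume) (ν := volume) Real.continuous_fourierChar continuous_inner
    (φ.integrable (μ := volume)) hf
  rw [flip_innerₗ] at self_adjoint
  calc ∫ x, φ x * (𝓕 (hf₂.toLp f) : Lp ℂ 2 (volume : Measure V)) x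
      = ∫ x, (𝓕 φ : 𝓢(V, ℂ)) x * hf₂.toLp f x := by
        rw [← toTemperedDistribution_apply_eq_integral, ← Lp.fourier_toTemperedDistribution_eq,
          TemperedDistribution.fourier_apply, toTemperedDistribution_apply_eq_integral]
    _ = ∫ x, 𝓕 (φ : V → ℂ) x * f x := by
        refine integral_congr_ae ?_
        filter_upwards [hf₂.coeFn_toLp] with x hx
        rw [hx, SchwartzMap.fourier_coe]
    _ = ∫ x, φ x * 𝓕 f x := self_adjoint

theorem smulLeftCLM_toTemperedDistribution_eq_iff {g : V → ℂ} (hg : g.HasTemperateGrowth)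
    (f h : Lp ℂ 2 (volume : Measure V)) :
    TemperedDistribution.smulLeftCLM ℂ g (f : 𝓢'(V, ℂ)) = (h : 𝓢'(V, ℂ)) ↔
      h =ᵐ[volume] fun x => g x * f x := by
  have apply_eq (φ : 𝓢(V, ℂ)) : TemperedDistribution.smulLeftCLM ℂ g (f : 𝓢'(V, ℂ)) φ
      = ∫ x, φ x * (g x * f x) := by
    rw [TemperedDistribution.smulLeftCLM_apply_apply, toTemperedDistribution_apply_eq_integral]
    refine integral_congr_ae (ae_of_all _ fun x => ?_)
    simp only [SchwartzMap.smulLeftCLM_apply_apply hg, smul_eq_mul]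
    ring
  constructor
  · intro e
    refine ae_eq_of_integral_schwartz_mul_eq (locallyIntegrable_coe_Lp_two h)
      ((locallyIntegrable_coe_Lp_two f).continuous_mul hg.1.continuous) fun φ => ?_
    rw [← apply_eq, e, toTemperedDistribution_apply_eq_integral]
  · intro e
    ext φ
    rw [apply_eq, toTemperedDistribution_apply_eq_integral]
    refine integral_congr_ae ?_
    filter_upwards [e] with x hx
    rw [hx]

theorem neg_laplacian_sub_eq_fourierMultiplier (T : 𝓢'(V, ℂ)) (z : ℂ) :
    -Δ T - z ^ 2 • T
      = TemperedDistribution.fourierMultiplierCLM ℂ (helmholtzSymbol z : V → ℂ) T := by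
  have hnorm : (fun ξ : V => ((‖ξ‖ ^ 2 : ℝ) : ℂ)).HasTemperateGrowth := by fun_prop
  have hsmul : (((4 * Real.pi ^ 2 : ℝ) : ℂ) •
      fun ξ : V => ((‖ξ‖ ^ 2 : ℝ) : ℂ)).HasTemperateGrowth := by
    simp only [Pi.smul_def, smul_eq_mul]
    fun_prop
  rw [TemperedDistribution.laplacian_eq_fourierMultiplierCLM, helmholtzSymbol_eq_smul_sub]
  simp only [TemperedDistribution.fourierMultiplierCLM_apply]
  rw [TemperedDistribution.smulLeftCLM_sub hsmul (by fun_prop),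
    TemperedDistribution.smulLeftCLM_smul hnorm]
  simp only [sub_apply, smul_apply, TemperedDistribution.smulLeftCLM_const]
  rw [sub_eq_add_neg, sub_eq_add_neg, FourierTransform.fourierInv_add,
    FourierTransform.fourierInv_neg, FourierTransform.fourierInv_smul,
    FourierTransform.fourierInv_smul, fourierInv_fourier_eq]
  congr 1
  ext φ
  simpa using Or.inl (by ring)

theorem eq_neg_laplacian_sub_iff_fourier (v w : Lp ℂ 2 (volume : Measure V)) (z : ℂ) :
    (w : 𝓢'(V, ℂ)) = -Δ (v : 𝓢'(V, ℂ)) - z ^ 2 • (v : 𝓢'(V, ℂ)) ↔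
      (𝓕 w : Lp ℂ 2 (volume : Measure V)) =ᵐ[volume]
        fun ξ => helmholtzSymbol z ξ * (𝓕 v : Lp ℂ 2 (volume : Measure V)) ξ := by
  rw [← smulLeftCLM_toTemperedDistribution_eq_iff (hasTemperateGrowth_helmholtzSymbol z),
    ← Lp.fourier_toTemperedDistribution_eq, ← Lp.fourier_toTemperedDistribution_eq,
    neg_laplacian_sub_eq_fourierMultiplier, TemperedDistribution.fourierMultiplierCLM_apply]
  constructor
  · intro h
    rw [h, fourier_fourierInv_eq]
  · intro h
    rw [h, fourierInv_fourier_eq]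

theorem memSobolev_two_of_fourier_ae_eq {v w : Lp ℂ 2 (volume : Measure V)} {z : ℂ}
    (h : (𝓕 w : Lp ℂ 2 (volume : Measure V)) =ᵐ[volume]
      fun ξ => helmholtzSymbol z ξ * (𝓕 v : Lp ℂ 2 (volume : Measure V)) ξ) :
    TemperedDistribution.MemSobolev 2 2 (v : 𝓢'(V, ℂ)) := by
  rw [TemperedDistribution.memSobolev_iff_exists_smulLeftCLM_fourier]
  set F : Lp ℂ 2 (volume : Measure V) := 𝓕 v
  set G : Lp ℂ 2 (volume : Measure V) := 𝓕 w
  have hpi : (Real.pi : ℂ) ≠ 0 := by exact_mod_cast Real.pi_ne_zero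
  refine ⟨F + (1 / (4 * (Real.pi : ℂ) ^ 2)) • (G + z ^ 2 • F), ?_⟩
  rw [Lp.fourier_toTemperedDistribution_eq,
    smulLeftCLM_toTemperedDistribution_eq_iff (by fun_prop)]
  filter_upwards [h, Lp.coeFn_add F ((1 / (4 * (Real.pi : ℂ) ^ 2)) • (G + z ^ 2 • F)),
    Lp.coeFn_smul (1 / (4 * (Real.pi : ℂ) ^ 2)) (G + z ^ 2 • F), Lp.coeFn_add G (z ^ 2 • F),
    Lp.coeFn_smul (z ^ 2) F] with ξ hG add_outer smul_outer add_inner smul_inner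
  rw [add_outer, Pi.add_apply, smul_outer, Pi.smul_apply, add_inner, Pi.add_apply, smul_inner,
    Pi.smul_apply, hG, helmholtzSymbol]
  simp only [smul_eq_mul, div_self (two_ne_zero' ℝ), Real.rpow_one]
  push_cast
  field_simp
  ring

theorem fourier_comp_sub_right (f : V → ℂ) (y ξ : V) :
    𝓕 (fun x => f (x - y)) ξ = Real.fourierChar (-inner ℝ y ξ) * 𝓕 f ξ := by
  have h := congrFun (VectorFourier.fourierIntegral_comp_add_right Real.fourierChar volume
    (innerₗ V) f (-y)) ξ
  simp only [Function.comp_def, ← sub_eq_add_neg, innerₗ_apply_apply, inner_neg_left,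
    Circle.smul_def, smul_eq_mul] at h
  exact h

theorem fourier_finsetSum {ι : Type*} (s : Finset ι) {f : ι → V → ℂ}
    (hf : ∀ j ∈ s, Integrable (f j)) (ξ : V) :
    𝓕 (fun x => ∑ j ∈ s, f j x) ξ = ∑ j ∈ s, 𝓕 (f j) ξ := by
  simp only [Real.fourier_eq, Finset.smul_sum]
  exact integral_finsetSum _ fun j hj => (Real.fourierIntegral_convergent_iff ξ).2 (hf j hj)

end Fourier

section PointCharges

variable {V ι : Type*} [NormedAddCommGroup V] [InnerProductSpace ℝ V] [Fintype ι]

/-- The exponential sum `∑_j q_j exp (-2πi ⟨y_j, ξ⟩)`, the Fourier transform of point charges `q_j`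
at `y_j`. -/
def expSum (y : ι → V) (q : ι → ℂ) (ξ : V) : ℂ :=
  ∑ j, q j * (Real.fourierChar (-inner ℝ (y j) ξ) : ℂ)

/-- The field `∑_j q_j 𝒢_z(x - y_j)` of point charges `q_j` at `y_j`. -/
def greenSum (z : ℂ) (y : ι → Plane) (q : ι → ℂ) (x : Plane) : ℂ :=
  ∑ j, q j * greenKernel z (x - y j)

theorem memLp_two_greenSum {z : ℂ} (hz : 0 < z.im) (y : ι → Plane) (q : ι → ℂ) :
    MemLp (greenSum z y q) 2 volume :=
  memLp_finsetSum _ fun j _ => ((memLp_two_greenKernel hz).comp_measurePreserving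
    (measurePreserving_sub_right volume (y j))).const_mul (q j)

theorem fourier_greenSum {z : ℂ} (hz : 0 < z.im) (y : ι → Plane) (q : ι → ℂ) :
    (𝓕 ((memLp_two_greenSum hz y q).toLp _) : L2Plane) =ᵐ[volume]
      fun ξ => expSum y q ξ / helmholtzSymbol z ξ := by
  have hint (j : ι) : Integrable fun x => q j * greenKernel z (x - y j) :=
    ((integrable_greenKernel hz).comp_sub_right (y j)).const_mul (q j)
  refine (fourier_toLp_ae_eq (integrable_finsetSum _ fun j _ => hint j) _).trans
    (ae_of_all _ fun ξ => ?_)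
  beta_reduce
  rw [fourier_finsetSum _ (fun j _ => hint j), expSum, Finset.sum_div]
  refine Finset.sum_congr rfl fun j _ => ?_
  rw [fourier_const_mul, fourier_comp_sub_right, fourier_greenKernel hz]
  ring

end PointCharges

/-! ### Moments of a charge distribution and integrability at the origin -/

section Homogeneous

variable {V : Type*} [NormedAddCommGroup V] [NormedSpace ℝ V] [FiniteDimensional ℝ V]
  [MeasurableSpace V] [BorelSpace V] {μ : Measure V} [μ.IsAddHaarMeasure]

-- By homogeneity the integral over the ball of radius `t` is independent of `t`, while it tends to
-- `0` with `t`.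
theorem ae_eq_zero_of_integrableOn_ball_of_homogeneous [Nontrivial V] {g : V → ℝ}
    (hg : 0 ≤ g) (hhom : ∀ t : ℝ, 0 < t → ∀ x, g (t • x) = (t ^ Module.finrank ℝ V)⁻¹ * g x)
    (hint : IntegrableOn g (Metric.ball 0 1) μ) : g =ᵐ[μ.restrict (Metric.ball 0 1)] 0 := by
  have integral_ball {t : ℝ} (ht : 0 < t) :
      ∫ x in Metric.ball 0 t, g x ∂μ = ∫ x in Metric.ball 0 1, g x ∂μ := by
    have h := Measure.setIntegral_comp_smul_of_pos μ g (Metric.ball 0 1) ht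
    simp only [hhom t ht, integral_const_mul, smul_unitBall_of_pos ht, smul_eq_mul] at h
    exact (mul_left_cancel₀ (inv_ne_zero (pow_ne_zero _ ht.ne')) h).symm
  have measure_ball : Tendsto (fun t : ℝ => μ.restrict (Metric.ball 0 1) (Metric.ball 0 t))
      (𝓝[>] 0) (𝓝 0) := by
    have h : Tendsto (fun t : ℝ => ENNReal.ofReal (t ^ Module.finrank ℝ V)
        * μ (Metric.ball 0 1)) (𝓝 0) (𝓝 0) := by
      have hpow : Tendsto (fun t : ℝ => ENNReal.ofReal (t ^ Module.finrank ℝ V)) (𝓝 0) (𝓝 0) :=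
        (ENNReal.continuous_ofReal.comp (continuous_pow _)).tendsto' _ _
          (by simp [Module.finrank_pos.ne'])
      simpa using ENNReal.Tendsto.mul_const hpow (Or.inr measure_ball_lt_top.ne)
    refine tendsto_of_tendsto_of_tendsto_of_le_of_le' tendsto_const_nhds
      (h.mono_left nhdsWithin_le_nhds) (Eventually.of_forall fun _ => zero_le) ?_
    filter_upwards [self_mem_nhdsWithin] with t ht
    exact (Measure.restrict_apply_le _ _).trans_eq (Measure.addHaar_ball μ 0 (le_of_lt ht))
  have integral_tendsto : Tendsto (fun t : ℝ => ∫ x in Metric.ball 0 t, g x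
      ∂(μ.restrict (Metric.ball 0 1))) (𝓝[>] 0) (𝓝 0) :=
    Integrable.tendsto_setIntegral_nhds_zero hint measure_ball
  refine (integral_eq_zero_iff_of_nonneg hg hint).1
    (tendsto_nhds_unique (tendsto_const_nhds.congr' ?_) integral_tendsto)
  filter_upwards [Ioo_mem_nhdsGT one_pos] with t ht
  rw [Measure.restrict_restrict measurableSet_ball,
    inter_eq_left.2 (Metric.ball_subset_ball ht.2.le), integral_ball ht.1]

theorem ae_eq_zero_of_memLp_two_ball_of_homogeneous (hV : Module.finrank ℝ V = 2) {f : V → ℂ}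
    (hhom : ∀ t : ℝ, 0 < t → ∀ x, ‖f (t • x)‖ = t⁻¹ * ‖f x‖)
    (hf : MemLp f 2 (μ.restrict (Metric.ball 0 1))) :
    f =ᵐ[μ.restrict (Metric.ball 0 1)] 0 := by
  have := Module.nontrivial_of_finrank_pos (hV.symm ▸ two_pos)
  have h : (fun x => ‖f x‖ ^ 2) =ᵐ[μ.restrict (Metric.ball 0 1)] 0 :=
    ae_eq_zero_of_integrableOn_ball_of_homogeneous (fun x => sq_nonneg ‖f x‖)
      (fun t ht x => by rw [hhom t ht, hV, mul_pow, inv_pow])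
      ((memLp_two_iff_integrable_sq_norm hf.1).1 hf)
  filter_upwards [h] with x hx
  simpa using hx

theorem eq_zero_of_memLp_two_ball_div_norm_pow (hV : Module.finrank ℝ V = 2) {p : V → ℂ}
    (hp : Continuous p) (k : ℕ) (hhom : ∀ t : ℝ, 0 < t → ∀ x, p (t • x) = t ^ k * p x)
    (h : MemLp (fun x => p x / (‖x‖ : ℂ) ^ (k + 1)) 2 (μ.restrict (Metric.ball 0 1))) :
    p = 0 := by
  have := Module.nontrivial_of_finrank_pos (hV.symm ▸ two_pos)
  have quotient_ae_zero := ae_eq_zero_of_memLp_two_ball_of_homogeneous hV (fun t ht x => by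
    rw [norm_smul, Real.norm_of_nonneg ht.le, hhom t ht, Complex.ofReal_mul, mul_pow, pow_succ,
      mul_assoc, mul_div_mul_left _ _ (by exact_mod_cast pow_ne_zero k ht.ne'), mul_comm (t : ℂ),
      ← div_div, div_eq_inv_mul _ (t : ℂ), norm_mul, norm_inv, Complex.norm_real,
      Real.norm_of_nonneg ht.le, mul_comm]) h
  have eqOn_ball : EqOn p 0 (Metric.ball 0 1) := by
    refine Measure.eqOn_open_of_ae_eq (μ := μ) ?_ Metric.isOpen_ball hp.continuousOn
      continuousOn_const
    filter_upwards [quotient_ae_zero, ae_restrict_of_ae (Measure.ae_ne μ 0)] with x hx hx0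
    simpa [hx0] using hx
  ext x
  have ht : 0 < (1 + ‖x‖)⁻¹ := by positivity
  have hmem : (1 + ‖x‖)⁻¹ • x ∈ Metric.ball (0 : V) 1 := by
    rw [mem_ball_zero_iff, norm_smul, Real.norm_of_nonneg ht.le, inv_mul_lt_one₀ (by positivity)]
    linarith
  have h0 := eqOn_ball hmem
  rw [hhom _ ht, Pi.zero_apply, mul_eq_zero] at h0
  exact h0.resolve_left (by exact_mod_cast pow_ne_zero k ht.ne')

theorem eq_zero_of_memLp_two_ball_affine_div_norm_sq (hV : Module.finrank ℝ V = 2) {A : ℂ}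
    {ℓ : V →L[ℝ] ℂ}
    (h : MemLp (fun x => (A + ℓ x) / (‖x‖ : ℂ) ^ 2) 2 (μ.restrict (Metric.ball 0 1))) :
    A = 0 ∧ ℓ = 0 := by
  have := Module.nontrivial_of_finrank_pos (hV.symm ▸ two_pos)
  have measurable_norm : Measurable fun x : V => (‖x‖ : ℂ) := by fun_prop
  have : IsFiniteMeasure (μ.restrict (Metric.ball (0 : V) 1)) :=
    isFiniteMeasure_restrict.2 measure_ball_lt_top.ne
  have affine_div_norm : MemLp (fun x => (A + ℓ x) / (‖x‖ : ℂ)) 2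
      (μ.restrict (Metric.ball 0 1)) := by
    refine h.mono ((by fun_prop : Measurable fun x => A + ℓ x).div
      measurable_norm).aestronglyMeasurable ?_
    filter_upwards [ae_restrict_mem measurableSet_ball, ae_restrict_of_ae (Measure.ae_ne μ 0)]
      with x hx hx0
    have hx1 : ‖x‖ ≤ 1 := (mem_ball_zero_iff.1 hx).le
    rw [norm_div, norm_div, norm_pow, Complex.norm_real, norm_norm, sq, ← div_div]
    exact le_div_self (by positivity) (norm_pos_iff.2 hx0) hx1
  have linear_div_norm : MemLp (fun x => ℓ x / (‖x‖ : ℂ)) 2 (μ.restrict (Metric.ball 0 1)) := by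
    refine MemLp.of_bound (ℓ.continuous.measurable.div measurable_norm).aestronglyMeasurable ‖ℓ‖
      (ae_of_all _ fun x => ?_)
    rw [norm_div, Complex.norm_real, norm_norm]
    exact div_le_of_le_mul₀ (norm_nonneg x) (norm_nonneg ℓ) (ℓ.le_opNorm x)
  have A_eq_zero : A = 0 := by
    refine congrFun (eq_zero_of_memLp_two_ball_div_norm_pow (μ := μ) hV (p := fun _ => A)
      continuous_const 0 (fun t _ _ => by rw [pow_zero, one_mul]) ?_) (0 : V)
    refine (affine_div_norm.sub linear_div_norm).ae_eq (ae_of_all _ fun x => ?_)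
    simp only [Pi.sub_apply, zero_add, pow_one, ← sub_div, add_sub_cancel_right]
  refine ⟨A_eq_zero, DFunLike.coe_injective (eq_zero_of_memLp_two_ball_div_norm_pow (μ := μ) hV
    ℓ.continuous 1 (fun t _ _ => by simp) ?_)⟩
  simpa only [A_eq_zero, zero_add] using h

end Homogeneous

section Moments

variable {V ι : Type*} [NormedAddCommGroup V] [InnerProductSpace ℝ V] [Fintype ι]

/-- The dipole moment `∑_j q_j y_j` of point charges `q_j` at `y_j`, as the linear form
`ξ ↦ ∑_j q_j ⟨y_j, ξ⟩`. -/
def dipoleForm (y : ι → V) (q : ι → ℂ) : V →L[ℝ] ℂ :=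
  ∑ j, (innerSL ℝ (y j)).smulRight (q j)

theorem dipoleForm_apply (y : ι → V) (q : ι → ℂ) (ξ : V) :
    dipoleForm y q ξ = ∑ j, q j * (inner ℝ (y j) ξ : ℂ) := by
  simp [dipoleForm, mul_comm]

theorem dipoleForm_eq_zero_iff {y : ι → Plane} {q : ι → ℂ} :
    dipoleForm y q = 0 ↔ ∀ i, ∑ j, q j * (y j i : ℂ) = 0 := by
  constructor
  · intro h i
    simpa [dipoleForm_apply, EuclideanSpace.inner_single_right] using
      DFunLike.congr_fun h (EuclideanSpace.single i (1 : ℝ))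
  · intro h
    ext ξ
    simp only [dipoleForm_apply, PiLp.inner_apply, RCLike.inner_apply, conj_trivial,
      Complex.ofReal_sum, Complex.ofReal_mul, Finset.mul_sum]
    rw [Finset.sum_comm]
    refine Finset.sum_eq_zero fun i _ => ?_
    simp only [mul_left_comm _ (ξ i : ℂ)]
    rw [← Finset.mul_sum, h, mul_zero]

theorem norm_cexp_I_mul_sub_one_sub_le (θ : ℝ) :
    ‖Complex.exp (Complex.I * θ) - 1 - Complex.I * θ‖ ≤ 2 * θ ^ 2 := by
  have hnorm : ‖Complex.I * (θ : ℂ)‖ = |θ| := by simp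
  rcases le_or_gt |θ| 1 with hθ | hθ
  · have h := Complex.norm_exp_sub_one_sub_id_le (x := Complex.I * θ) (hnorm.trans_le hθ)
    rw [hnorm, sq_abs] at h
    linarith [sq_nonneg θ]
  · have hexp : ‖Complex.exp (Complex.I * θ) - 1‖ ≤ |θ| := Real.norm_exp_I_mul_ofReal_sub_one_le
    have h := norm_sub_le (Complex.exp (Complex.I * θ) - 1) (Complex.I * θ)
    rw [← sq_abs]
    nlinarith

theorem norm_fourierChar_neg_inner_sub_le (y ξ : V) :
    ‖(Real.fourierChar (-inner ℝ y ξ) : ℂ)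
      - (1 - 2 * Real.pi * Complex.I * (inner ℝ y ξ : ℂ))‖
      ≤ 2 * (2 * Real.pi * ‖y‖) ^ 2 * ‖ξ‖ ^ 2 := by
  have h := norm_cexp_I_mul_sub_one_sub_le (-(2 * Real.pi * inner ℝ y ξ))
  have hinner : (inner ℝ y ξ : ℝ) ^ 2 ≤ (‖y‖ * ‖ξ‖) ^ 2 :=
    sq_le_sq' (neg_le_of_abs_le (abs_real_inner_le_norm y ξ)) (real_inner_le_norm y ξ)
  calc _ = ‖Complex.exp (Complex.I * (-(2 * Real.pi * inner ℝ y ξ) : ℝ)) - 1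
        - Complex.I * (-(2 * Real.pi * inner ℝ y ξ) : ℝ)‖ := by
        rw [Real.fourierChar_apply]
        congr 1
        push_cast
        ring_nf
    _ ≤ 2 * (2 * Real.pi) ^ 2 * inner ℝ y ξ ^ 2 := h.trans_eq (by ring)
    _ ≤ 2 * (2 * Real.pi) ^ 2 * (‖y‖ * ‖ξ‖) ^ 2 := by gcongr
    _ = _ := by ring

theorem norm_expSum_le (y : ι → V) (q : ι → ℂ) (ξ : V) : ‖expSum y q ξ‖ ≤ ∑ j, ‖q j‖ :=
  (norm_sum_le _ _).trans_eq <| Finset.sum_congr rfl fun j _ => by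
    rw [norm_mul, Circle.norm_coe, mul_one]

theorem norm_expSum_sub_le (y : ι → V) (q : ι → ℂ) (ξ : V) :
    ‖expSum y q ξ - (∑ j, q j - 2 * Real.pi * Complex.I * dipoleForm y q ξ)‖
      ≤ (∑ j, ‖q j‖ * (2 * (2 * Real.pi * ‖y j‖) ^ 2)) * ‖ξ‖ ^ 2 := by
  have h : expSum y q ξ - (∑ j, q j - 2 * Real.pi * Complex.I * dipoleForm y q ξ)
      = ∑ j, q j * ((Real.fourierChar (-inner ℝ (y j) ξ) : ℂ)
        - (1 - 2 * Real.pi * Complex.I * (inner ℝ (y j) ξ : ℂ))) := by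
    rw [expSum, dipoleForm_apply, Finset.mul_sum, ← Finset.sum_sub_distrib,
      ← Finset.sum_sub_distrib]
    exact Finset.sum_congr rfl fun j _ => by ring
  rw [h, Finset.sum_mul]
  refine (norm_sum_le _ _).trans (Finset.sum_le_sum fun j _ => ?_)
  rw [norm_mul, mul_assoc ‖q j‖]
  gcongr
  exact norm_fourierChar_neg_inner_sub_le (y j) ξ

theorem continuous_expSum (y : ι → V) (q : ι → ℂ) : Continuous (expSum y q) := by
  have := Real.continuous_fourierChar
  unfold expSum
  fun_prop

theorem exists_norm_expSum_mul_le {y : ι → V} {q : ι → ℂ} (hq : ∑ j, q j = 0)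
    (hdipole : dipoleForm y q = 0) :
    ∃ C, 0 ≤ C ∧ ∀ ξ, ‖expSum y q ξ‖ * (1 + ‖ξ‖ ^ 2) ≤ C * ‖ξ‖ ^ 2 := by
  refine ⟨∑ j, ‖q j‖ * (2 * (2 * Real.pi * ‖y j‖) ^ 2) + ∑ j, ‖q j‖, by positivity, fun ξ => ?_⟩
  have hquadratic := norm_expSum_sub_le y q ξ
  rw [hq, hdipole, zero_apply, mul_zero, sub_zero, sub_zero] at hquadratic
  have hbounded := mul_le_mul_of_nonneg_right (norm_expSum_le y q ξ) (sq_nonneg ‖ξ‖)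
  linarith

theorem moments_eq_zero_of_memLp_two_expSum_div [FiniteDimensional ℝ V] [MeasurableSpace V]
    [BorelSpace V] (hV : Module.finrank ℝ V = 2) {μ : Measure V} [μ.IsAddHaarMeasure]
    {y : ι → V} {q : ι → ℂ}
    (h : MemLp (fun ξ => expSum y q ξ / (‖ξ‖ : ℂ) ^ 2) 2 (μ.restrict (Metric.ball 0 1))) :
    ∑ j, q j = 0 ∧ dipoleForm y q = 0 := by
  have : IsFiniteMeasure (μ.restrict (Metric.ball (0 : V) 1)) :=
    isFiniteMeasure_restrict.2 measure_ball_lt_top.ne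
  set C := ∑ j, ‖q j‖ * (2 * (2 * Real.pi * ‖y j‖) ^ 2)
  set ℓ : V →L[ℝ] ℂ := (-(2 * Real.pi * Complex.I)) • dipoleForm y q
  have hℓ (ξ : V) : ∑ j, q j + ℓ ξ = ∑ j, q j - 2 * Real.pi * Complex.I * dipoleForm y q ξ := by
    rw [smul_apply, smul_eq_mul, neg_mul, sub_eq_add_neg]
  have remainder : MemLp (fun ξ => (expSum y q ξ - (∑ j, q j + ℓ ξ)) / (‖ξ‖ : ℂ) ^ 2) 2
      (μ.restrict (Metric.ball 0 1)) := by
    have hmeas : Measurable fun ξ => (expSum y q ξ - (∑ j, q j + ℓ ξ)) / (‖ξ‖ : ℂ) ^ 2 :=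
      ((continuous_expSum y q).measurable.sub (by fun_prop)).div (by fun_prop)
    refine MemLp.of_bound hmeas.aestronglyMeasurable C (ae_of_all _ fun ξ => ?_)
    rw [norm_div, norm_pow, Complex.norm_real, norm_norm, hℓ]
    exact div_le_of_le_mul₀ (by positivity) (by positivity) (norm_expSum_sub_le y q ξ)
  have affine : MemLp (fun ξ => (∑ j, q j + ℓ ξ) / (‖ξ‖ : ℂ) ^ 2) 2
      (μ.restrict (Metric.ball 0 1)) := by
    refine (h.sub remainder).ae_eq (ae_of_all _ fun ξ => ?_)
    simp only [Pi.sub_apply, ← sub_div, sub_sub_cancel]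
  obtain ⟨hq, hzero⟩ := eq_zero_of_memLp_two_ball_affine_div_norm_sq hV affine
  exact ⟨hq, (smul_eq_zero.1 hzero).resolve_left (by simp [Real.pi_ne_zero])⟩

end Moments

/-! ### The logarithmic potential as a limit of Green potentials -/

theorem tendsto_Lp_of_dominated {X E : Type*} [MeasurableSpace X] [NormedAddCommGroup E]
    {μ : Measure X} {p : ℝ≥0∞} [Fact (1 ≤ p)] (hp : p ≠ ⊤) {F : ℕ → Lp E p μ} {G : Lp E p μ}
    {b : X → ℝ} (hb : MemLp b p μ) (hle : ∀ n, ∀ᵐ x ∂μ, ‖F n x - G x‖ ≤ b x)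
    (hlim : ∀ᵐ x ∂μ, Tendsto (fun n => F n x) atTop (𝓝 (G x))) : Tendsto F atTop (𝓝 G) := by
  have hp0 : p ≠ 0 := (one_pos.trans_le Fact.out).ne'
  have hp_pos : 0 < p.toReal := ENNReal.toReal_pos hp0 hp
  have lintegral_tendsto : Tendsto (fun n => ∫⁻ x, ‖F n x - G x‖ₑ ^ p.toReal ∂μ) atTop
      (𝓝 (∫⁻ _, 0 ∂μ)) := by
    refine tendsto_lintegral_of_dominated_convergence' (fun x => ‖b x‖ₑ ^ p.toReal)
      (fun n => ((Lp.aestronglyMeasurable _).sub (Lp.aestronglyMeasurable _)).enorm.pow_const _)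
      (fun n => ?_) (lintegral_rpow_enorm_lt_top_of_eLpNorm_lt_top hp0 hp hb.2).ne ?_
    · filter_upwards [hle n] with x hx
      gcongr
      exact enorm_le_iff_norm_le.2 (hx.trans (le_abs_self _))
    · filter_upwards [hlim] with x hx
      have h := ((hx.sub_const (G x)).enorm).ennrpow_const p.toReal
      rwa [sub_self, enorm_zero, ENNReal.zero_rpow_of_pos hp_pos] at h
  rw [Lp.tendsto_Lp_iff_tendsto_eLpNorm']
  simp only [eLpNorm_eq_lintegral_rpow_enorm_toReal hp0 hp, Pi.sub_apply]
  have h := lintegral_tendsto.ennrpow_const (1 / p.toReal)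
  rwa [lintegral_zero, ENNReal.zero_rpow_of_pos (one_div_pos.2 hp_pos)] at h

theorem helmholtzSymbol_I_mul {V : Type*} [Norm V] (κ : ℝ) (ξ : V) :
    helmholtzSymbol (Complex.I * κ) ξ = (4 * Real.pi ^ 2 * ‖ξ‖ ^ 2 + κ ^ 2 : ℝ) := by
  rw [helmholtzSymbol, mul_pow, Complex.I_sq]
  push_cast
  ring

theorem memLp_two_const_div_one_add_norm_sq {V : Type*} [NormedAddCommGroup V]
    [NormedSpace ℝ V] [FiniteDimensional ℝ V] [MeasurableSpace V] [BorelSpace V]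
    (hV : Module.finrank ℝ V < 4) (C : ℝ) (μ : Measure V) [μ.IsAddHaarMeasure] :
    MemLp (fun ξ => C / (1 + ‖ξ‖ ^ 2)) 2 μ := by
  have hmeas : Measurable fun ξ : V => C / (1 + ‖ξ‖ ^ 2) := by fun_prop
  rw [memLp_two_iff_integrable_sq hmeas.aestronglyMeasurable]
  have h := (integrable_rpow_neg_one_add_norm_sq (μ := μ) (r := 4)
    (by exact_mod_cast hV)).const_mul (C ^ 2)
  refine h.congr (ae_of_all _ fun ξ => ?_)
  beta_reduce
  rw [show (-4 / 2 : ℝ) = -(2 : ℕ) by norm_num, Real.rpow_neg (by positivity),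
    Real.rpow_natCast, div_pow, div_eq_mul_inv]

theorem norm_expSum_div_helmholtzSymbol_le {V ι : Type*} [NormedAddCommGroup V]
    [InnerProductSpace ℝ V] [Fintype ι] {y : ι → V} {q : ι → ℂ} {C : ℝ}
    (hC : 0 ≤ C) (h : ∀ ξ, ‖expSum y q ξ‖ * (1 + ‖ξ‖ ^ 2) ≤ C * ‖ξ‖ ^ 2) (κ : ℝ) (ξ : V) :
    ‖expSum y q ξ / helmholtzSymbol (Complex.I * κ) ξ‖ ≤ C / (1 + ‖ξ‖ ^ 2) := by
  have hpi := Real.pi_gt_three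
  have symbol_ge : ‖ξ‖ ^ 2 ≤ ‖helmholtzSymbol (Complex.I * κ) ξ‖ := by
    rw [helmholtzSymbol_I_mul, Complex.norm_real, Real.norm_of_nonneg (by positivity)]
    have hpi_sq : 1 ≤ 4 * Real.pi ^ 2 := by nlinarith
    linarith [sq_nonneg κ, le_mul_of_one_le_left (sq_nonneg ‖ξ‖) hpi_sq]
  rw [norm_div]
  refine div_le_of_le_mul₀ (norm_nonneg _) (by positivity) ?_
  rw [div_mul_eq_mul_div, le_div_iff₀ (by positivity)]
  exact (h ξ).trans (by gcongr)

section LogPotential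

variable {N : ℕ}

theorem I_mul_ofReal_im_pos {κ : ℝ} (hκ : 0 < κ) : 0 < (Complex.I * κ).im := by
  simpa using hκ

theorem memLp_two_expSum_div_helmholtzSymbol_zero {y : Fin N → Plane} {q : Fin N → ℂ}
    (hq : ∑ j, q j = 0) (hdipole : dipoleForm y q = 0) :
    MemLp (fun ξ => expSum y q ξ / helmholtzSymbol 0 ξ) 2 := by
  obtain ⟨C, hC, hbound⟩ := exists_norm_expSum_mul_le hq hdipole
  refine (memLp_two_const_div_one_add_norm_sq (by rw [finrank_plane]; norm_num) C volume).mono'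
    ((continuous_expSum y q).measurable.div
      (hasTemperateGrowth_helmholtzSymbol 0).1.continuous.measurable).aestronglyMeasurable
    (ae_of_all _ fun ξ => ?_)
  simpa using norm_expSum_div_helmholtzSymbol_le hC hbound 0 ξ

theorem tendsto_toLp_greenSum {y : Fin N → Plane} {q : Fin N → ℂ} (hq : ∑ j, q j = 0)
    (hdipole : dipoleForm y q = 0) {ψ : L2Plane}
    (hψ : (𝓕 ψ : L2Plane) =ᵐ[volume] fun ξ => expSum y q ξ / helmholtzSymbol 0 ξ)
    {κ : ℕ → ℝ} (hκ : ∀ n, 0 < κ n) (hlim : Tendsto κ atTop (𝓝 0)) :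
    Tendsto (fun n => (memLp_two_greenSum (I_mul_ofReal_im_pos (hκ n)) y q).toLp _) atTop
      (𝓝 ψ) := by
  obtain ⟨C, hC, hbound⟩ := exists_norm_expSum_mul_le hq hdipole
  have quotient_le := norm_expSum_div_helmholtzSymbol_le hC hbound
  have fourier_eq (n : ℕ) := fourier_greenSum (I_mul_ofReal_im_pos (hκ n)) y q
  have fourier_tendsto : Tendsto (fun n =>
      (𝓕 ((memLp_two_greenSum (I_mul_ofReal_im_pos (hκ n)) y q).toLp _) : L2Plane)) atTop
      (𝓝 (𝓕 ψ)) := by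
    refine tendsto_Lp_of_dominated ENNReal.ofNat_ne_top (memLp_two_const_div_one_add_norm_sq
      (by rw [finrank_plane]; norm_num) (2 * C) volume) (fun n => ?_) ?_
    · filter_upwards [fourier_eq n, hψ] with ξ hn h0
      rw [hn, h0, mul_div_assoc, two_mul]
      refine norm_sub_le_of_le (quotient_le (κ n) ξ) ?_
      simpa using quotient_le 0 ξ
    · filter_upwards [ae_all_iff.2 fourier_eq, hψ, ae_ne_zero_plane] with ξ hn h0 hξ
      simp only [hn, h0]
      have hcont : Continuous fun k : ℝ => helmholtzSymbol (Complex.I * k) ξ := by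
        unfold helmholtzSymbol
        fun_prop
      refine tendsto_const_nhds.div ((hcont.tendsto' 0 _ (by simp)).comp hlim) ?_
      simp [helmholtzSymbol, hξ, Real.pi_ne_zero]
  exact (Lp.fourierTransformₗᵢ Plane ℂ).isometry.isEmbedding.tendsto_nhds_iff.2 fourier_tendsto

theorem tendsto_greenSum_logPotential {y : Fin N → Plane} {q : Fin N → ℂ} (hq : ∑ j, q j = 0)
    {x : Plane} (hx : ∀ j, x ≠ y j) :
    Tendsto (fun κ : ℝ => greenSum (Complex.I * κ) y q x) (𝓝[>] 0) (𝓝 (logPotential y q x)) := by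
  have hpos (j : Fin N) : 0 < ‖x - y j‖ := norm_pos_iff.2 (sub_ne_zero.2 (hx j))
  have sum_mul_add (f : Fin N → ℂ) (c : ℂ) : ∑ j, q j * (f j + c) = ∑ j, q j * f j := by
    simp only [mul_add, Finset.sum_add_distrib, ← Finset.sum_mul, hq, zero_mul, add_zero]
  have green_eq (κ : ℝ) : greenSum (Complex.I * κ) y q x
      = ∑ j, q j * (1 / (2 * (Real.pi : ℂ)) * (besselK ((‖x - y j‖ : ℂ) * κ) + Real.log κ)) := by
    simp only [mul_add (1 / (2 * (Real.pi : ℂ))), sum_mul_add]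
    refine Finset.sum_congr rfl fun j _ => ?_
    rw [greenKernel_eq_besselK]
    congr 3
    linear_combination -(κ : ℂ) * (‖x - y j‖ : ℂ) * Complex.I_sq
  have potential_eq : logPotential y q x = ∑ j, q j * (1 / (2 * (Real.pi : ℂ)) *
      (-Complex.log ((‖x - y j‖ : ℂ) / 2) - Real.eulerMascheroniConstant)) := by
    have log_eq (j : Fin N) : Complex.log ((‖x - y j‖ : ℂ) / 2)
        = Real.log ‖x - y j‖ - Real.log 2 := by
      rw [← Complex.ofReal_ofNat, ← Complex.ofReal_div, ← Complex.ofReal_log (by positivity),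
        Real.log_div (hpos j).ne' two_ne_zero, Complex.ofReal_sub]
    rw [logPotential, ← Finset.sum_neg_distrib, ← sum_mul_add _
      (1 / (2 * (Real.pi : ℂ)) * (Real.eulerMascheroniConstant - Real.log 2))]
    refine Finset.sum_congr rfl fun j _ => ?_
    rw [log_eq]
    ring
  simp only [green_eq, potential_eq]
  exact tendsto_finsetSum _ fun j _ =>
    ((tendsto_besselK_add_log (by exact_mod_cast hpos j)).const_mul _).const_mul _

theorem ae_eq_logPotential_of_fourier {y : Fin N → Plane} {q : Fin N → ℂ} (hq : ∑ j, q j = 0)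
    (hdipole : dipoleForm y q = 0) {ψ : L2Plane}
    (hψ : (𝓕 ψ : L2Plane) =ᵐ[volume] fun ξ => expSum y q ξ / helmholtzSymbol 0 ξ) :
    ψ =ᵐ[volume] logPotential y q := by
  have hκ (n : ℕ) : (0 : ℝ) < 1 / (n + 1) := by positivity
  have hlim : Tendsto (fun n : ℕ => (1 : ℝ) / (n + 1)) atTop (𝓝 0) :=
    tendsto_one_div_add_atTop_nhds_zero_nat
  obtain ⟨ns, hns, hsub⟩ := (tendstoInMeasure_of_tendsto_Lp
    (tendsto_toLp_greenSum hq hdipole hψ hκ hlim)).exists_seq_tendsto_ae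
  filter_upwards [hsub, ae_all_iff.2 fun j => Measure.ae_ne volume (y j), ae_all_iff.2 fun n =>
    (memLp_two_greenSum (I_mul_ofReal_im_pos (hκ n)) y q).coeFn_toLp] with x hx hxy hcoe
  simp only [hcoe] at hx
  refine tendsto_nhds_unique hx ((tendsto_greenSum_logPotential hq hxy).comp ?_)
  exact tendsto_nhdsWithin_iff.2 ⟨hlim.comp hns.tendsto_atTop, Eventually.of_forall fun i => hκ _⟩

theorem exists_fourier_ae_eq_expSum_div {y : Fin N → Plane} {q : Fin N → ℂ} (hq : ∑ j, q j = 0)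
    (hdipole : dipoleForm y q = 0) : ∃ φ : L2Plane,
      (𝓕 φ : L2Plane) =ᵐ[volume] fun ξ => expSum y q ξ / helmholtzSymbol 0 ξ := by
  have hmem := memLp_two_expSum_div_helmholtzSymbol_zero hq hdipole
  refine ⟨𝓕⁻ (hmem.toLp _), ?_⟩
  rw [fourier_fourierInv_eq]
  exact hmem.coeFn_toLp

theorem memLp_two_logPotential {y : Fin N → Plane} {q : Fin N → ℂ} (hq : ∑ j, q j = 0)
    (hdipole : dipoleForm y q = 0) : MemLp (logPotential y q) 2 volume := by
  obtain ⟨φ, hφ⟩ := exists_fourier_ae_eq_expSum_div hq hdipole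
  exact (Lp.memLp φ).ae_eq (ae_eq_logPotential_of_fourier hq hdipole hφ)

theorem fourier_eq_expSum_div_iff {y : Fin N → Plane} {q : Fin N → ℂ} {ψ : L2Plane} :
    ((𝓕 ψ : L2Plane) =ᵐ[volume] fun ξ => expSum y q ξ / helmholtzSymbol 0 ξ) ↔
      ∑ j, q j = 0 ∧ dipoleForm y q = 0 ∧ ψ =ᵐ[volume] logPotential y q := by
  constructor
  · intro h
    have quotient_memLp : MemLp (fun ξ => expSum y q ξ / (‖ξ‖ : ℂ) ^ 2) 2 volume := by
      refine (((Lp.memLp (𝓕 ψ : L2Plane)).ae_eq h).const_mul (4 * (Real.pi : ℂ) ^ 2)).ae_eq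
        (ae_of_all _ fun ξ => ?_)
      have hpi : (Real.pi : ℂ) ≠ 0 := by exact_mod_cast Real.pi_ne_zero
      rw [helmholtzSymbol, zero_pow two_ne_zero, sub_zero, ← mul_div_assoc,
        mul_div_mul_left _ _ (by simp [hpi])]
    obtain ⟨hq, hdipole⟩ := moments_eq_zero_of_memLp_two_expSum_div finrank_plane
      (quotient_memLp.restrict (Metric.ball 0 1))
    exact ⟨hq, hdipole, ae_eq_logPotential_of_fourier hq hdipole h⟩
  · rintro ⟨hq, hdipole, hψ⟩
    obtain ⟨φ, hφ⟩ := exists_fourier_ae_eq_expSum_div hq hdipole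
    rwa [Lp.ext (hψ.trans (ae_eq_logPotential_of_fourier hq hdipole hφ).symm)]

end LogPotential

/-! ### The regular part of the Green kernel -/

section Regular

variable {N : ℕ}

/-- The value at the origin of the continuous function `-(2π)⁻¹ log |x| - 𝒢_z(x)`; the diagonal
entries of `Γ_{α,Y}(z)` are `α_j` plus this constant. -/
def greenConst (z : ℂ) : ℂ :=
  1 / (2 * (Real.pi : ℂ)) * Complex.log (z / 2) - Complex.I / 4
    + (Real.eulerMascheroniConstant : ℂ) / (2 * (Real.pi : ℂ))

open Classical in
/-- The continuous extension of `-(2π)⁻¹ log |x| - 𝒢_z(x)` to the plane. -/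
def greenRegular (z : ℂ) (x : Plane) : ℂ :=
  if x = 0 then greenConst z
  else -(1 / (2 * (Real.pi : ℂ)) * (Real.log ‖x‖ : ℂ)) - greenKernel z x

theorem log_neg_I_mul_div_two {z : ℂ} (hz : 0 < z.im) :
    Complex.log (-Complex.I * z / 2) = Complex.log (z / 2) - Real.pi / 2 * Complex.I := by
  have him : 0 < (z / 2).im := by rw [Complex.div_ofNat_im]; linarith
  have hne : z / 2 ≠ 0 := by rintro h; simp [h] at him
  have arg_nonneg : 0 ≤ Complex.arg (z / 2) := Complex.arg_nonneg_iff.2 him.le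
  have arg_le : Complex.arg (z / 2) ≤ Real.pi := Complex.arg_le_pi _
  have hpi := Real.pi_pos
  rw [mul_div_assoc, Complex.log_mul (neg_ne_zero.2 Complex.I_ne_zero) hne
    (by rw [Complex.arg_neg_I]; constructor <;> linarith), Complex.log_neg_I]
  ring

theorem tendsto_log_add_greenKernel {z : ℂ} (hz : 0 < z.im) :
    Tendsto (fun x : Plane => -(1 / (2 * (Real.pi : ℂ)) * (Real.log ‖x‖ : ℂ)) - greenKernel z x)
      (𝓝[≠] 0) (𝓝 (greenConst z)) := by
  have h := ((tendsto_besselK_add_log (ζ := -Complex.I * z) (by rwa [re_neg_I_mul])).comp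
    (tendsto_norm_nhdsNE_zero (E := Plane))).const_mul (-(1 / (2 * (Real.pi : ℂ))))
  have limit_eq : -(1 / (2 * (Real.pi : ℂ))) * (-Complex.log (-Complex.I * z / 2)
      - Real.eulerMascheroniConstant) = greenConst z := by
    have hpi : (Real.pi : ℂ) ≠ 0 := by exact_mod_cast Real.pi_ne_zero
    rw [log_neg_I_mul_div_two hz, greenConst]
    field_simp
    ring
  rw [limit_eq] at h
  refine h.congr fun x => ?_
  rw [greenKernel_eq_besselK, Function.comp_apply]
  ring

theorem continuous_greenRegular {z : ℂ} (hz : 0 < z.im) : Continuous (greenRegular z) := by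
  have eventuallyEq (l : Filter Plane) (hl : {x | x ≠ 0} ∈ l) :
      (fun x : Plane => -(1 / (2 * (Real.pi : ℂ)) * (Real.log ‖x‖ : ℂ)) - greenKernel z x)
        =ᶠ[l] greenRegular z := by
    filter_upwards [hl] with x hx
    rw [greenRegular, if_neg hx]
  refine continuous_iff_continuousAt.2 fun x => ?_
  rcases eq_or_ne x 0 with rfl | hx
  · rw [continuousAt_iff_punctured_nhds, greenRegular, if_pos rfl]
    exact (tendsto_log_add_greenKernel hz).congr' (eventuallyEq _ self_mem_nhdsWithin)
  · have continuousAt_log : ContinuousAt (fun x : Plane => (Real.log ‖x‖ : ℂ)) x :=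
      Complex.continuous_ofReal.continuousAt.comp
        (continuous_norm.continuousAt.log (norm_ne_zero_iff.2 hx))
    exact ((continuousAt_log.const_mul _).neg.sub (continuousAt_greenKernel hz hx)).congr
      (eventuallyEq _ (isOpen_ne.mem_nhds hx))

/-- The continuous extension of `logPotential y q - greenSum z y q` to the plane. -/
def regularSum (y : Fin N → Plane) (z : ℂ) (q : Fin N → ℂ) (x : Plane) : ℂ :=
  ∑ j, q j * greenRegular z (x - y j)

theorem continuous_regularSum {z : ℂ} (hz : 0 < z.im) (y : Fin N → Plane) (q : Fin N → ℂ) :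
    Continuous (regularSum y z q) := by
  have := continuous_greenRegular hz
  unfold regularSum
  fun_prop

theorem regularSum_eq_logPotential_sub {y : Fin N → Plane} {x : Plane} (hx : ∀ j, x ≠ y j) (z : ℂ)
    (q : Fin N → ℂ) : regularSum y z q x = logPotential y q x - greenSum z y q x := by
  rw [regularSum, logPotential, greenSum, ← Finset.sum_neg_distrib, ← Finset.sum_sub_distrib]
  refine Finset.sum_congr rfl fun j _ => ?_
  rw [greenRegular, if_neg (sub_ne_zero.2 (hx j))]
  ring

theorem regularSum_ae_eq (y : Fin N → Plane) (z : ℂ) (q : Fin N → ℂ) :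
    regularSum y z q =ᵐ[volume] fun x => logPotential y q x - greenSum z y q x := by
  filter_upwards [ae_all_iff.2 fun j => Measure.ae_ne volume (y j)] with x hx
  exact regularSum_eq_logPotential_sub hx z q

theorem regularSum_apply_point (α : Fin N → ℝ) {y : Fin N → Plane} (hy : Function.Injective y)
    (z : ℂ) (q : Fin N → ℂ) (k : Fin N) :
    regularSum y z q (y k) = (gammaMatrix α y z).mulVec q k
      - ((dMatrix α y).map Complex.ofReal).mulVec q k := by
  simp only [regularSum, Matrix.mulVec, dotProduct, ← Finset.sum_sub_distrib]
  refine Finset.sum_congr rfl fun j _ => ?_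
  rcases eq_or_ne k j with rfl | hkj
  · simp only [gammaMatrix, dMatrix, Matrix.of_apply, Matrix.map_apply, if_true, sub_self,
      greenRegular, greenConst]
    ring
  · simp only [gammaMatrix, dMatrix, Matrix.of_apply, Matrix.map_apply, if_neg hkj, greenRegular,
      if_neg (sub_ne_zero.2 (hy.ne hkj))]
    push_cast
    ring

theorem eq_zero_of_mul_log_norm_sub_ae_eq {V : Type*} [NormedAddCommGroup V] [MeasurableSpace V]
    {μ : Measure V} [μ.IsOpenPosMeasure] [NullSingletonClass μ] {a : V} {c : ℂ} {g : V → ℂ}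
    (hg : ContinuousAt g a) (h : (fun x => c * (Real.log ‖x - a‖ : ℂ)) =ᵐ[μ] g) : c = 0 := by
  by_contra hc
  set S : Set V := {x | c * (Real.log ‖x - a‖ : ℂ) = g x ∧ x ≠ a}
  have S_dense : Dense S := Measure.dense_of_ae (h.and (Measure.ae_ne μ a))
  have : (𝓝[S] a).NeBot := mem_closure_iff_nhdsWithin_neBot.1 (S_dense a)
  have norm_tendsto : Tendsto (fun x => ‖x - a‖) (𝓝[S] a) (𝓝[>] 0) := by
    refine tendsto_nhdsWithin_iff.2 ⟨?_, ?_⟩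
    · exact ((by fun_prop : Continuous fun x => ‖x - a‖).tendsto' a 0 (by simp)).mono_left
        nhdsWithin_le_nhds
    · filter_upwards [self_mem_nhdsWithin] with x hx
      exact norm_pos_iff.2 (sub_ne_zero.2 hx.2)
  have norm_g_tendsto : Tendsto (fun x => ‖g x‖) (𝓝[S] a) atTop := by
    refine ((tendsto_abs_atBot_atTop.comp (Real.tendsto_log_nhdsGT_zero.comp
      norm_tendsto)).const_mul_atTop (norm_pos_iff.2 hc)).congr' ?_
    filter_upwards [self_mem_nhdsWithin] with x hx
    rw [← hx.1, norm_mul, Complex.norm_real]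
    rfl
  exact not_tendsto_nhds_of_tendsto_atTop norm_g_tendsto _
    (hg.tendsto.mono_left nhdsWithin_le_nhds).norm

theorem eq_zero_of_logPotential_ae_eq {y : Fin N → Plane} (hy : Function.Injective y)
    {q : Fin N → ℂ} {f : Plane → ℂ} (hf : Continuous f) (h : logPotential y q =ᵐ[volume] f) :
    q = 0 := by
  ext k
  have hpi : (Real.pi : ℂ) ≠ 0 := by exact_mod_cast Real.pi_ne_zero
  have log_continuousAt {j : Fin N} (hj : j ∈ Finset.univ.erase k) :
      ContinuousAt (fun x => (Real.log ‖x - y j‖ : ℂ)) (y k) :=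
    Complex.continuous_ofReal.continuousAt.comp (ContinuousAt.log (by fun_prop)
      (norm_ne_zero_iff.2 (sub_ne_zero.2 (hy.ne (Finset.ne_of_mem_erase hj).symm))))
  have coeff_eq_zero : -(q k / (2 * (Real.pi : ℂ))) = 0 := by
    refine eq_zero_of_mul_log_norm_sub_ae_eq (μ := (volume : Measure Plane)) (a := y k)
      (g := fun x => f x
        + ∑ j ∈ Finset.univ.erase k, q j / (2 * (Real.pi : ℂ)) * (Real.log ‖x - y j‖ : ℂ))
      (hf.continuousAt.add (tendsto_finsetSum _ fun j hj => (log_continuousAt hj).const_mul _)) ?_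
    filter_upwards [h] with x hx
    rw [← hx, logPotential, ← Finset.add_sum_erase _ _ (Finset.mem_univ k)]
    ring
  simpa [hpi] using coeff_eq_zero

end Regular

/-! ### Admissible points -/

section Admissible

variable {N : ℕ}

theorem tendsto_greenKernel_I_mul_atTop {x : Plane} (hx : x ≠ 0) :
    Tendsto (fun κ : ℝ => greenKernel (Complex.I * κ) x) atTop (𝓝 0) := by
  have hx_pos : 0 < ‖x‖ := norm_pos_iff.2 hx
  have inv_sqrt_tendsto : Tendsto (fun κ : ℝ => 1 / √(κ * ‖x‖)) atTop (𝓝 0) := by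
    simpa only [Function.comp_def, Pi.inv_def, one_div, id] using
      (Real.tendsto_sqrt_atTop.comp (tendsto_id.atTop_mul_const hx_pos)).inv_tendsto_atTop
  refine squeeze_zero_norm' ?_ inv_sqrt_tendsto
  filter_upwards [eventually_gt_atTop 0] with κ hκ
  have him : (Complex.I * (κ : ℂ)).im = κ := by simp
  refine (norm_greenKernel_le (I_mul_ofReal_im_pos hκ) hx).trans ?_
  rw [him]
  gcongr
  exact Real.exp_le_one_iff.2 (by linarith [mul_pos hκ hx_pos])

theorem gammaMatrix_I_mul_diag (α : Fin N → ℝ) (y : Fin N → Plane) {κ : ℝ} (hκ : 0 < κ)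
    (k : Fin N) : gammaMatrix α y (Complex.I * κ) k k
      = (α k + 1 / (2 * Real.pi) * (Real.log (κ / 2) + Real.eulerMascheroniConstant) : ℝ) := by
  have hpi : (Real.pi : ℂ) ≠ 0 := by exact_mod_cast Real.pi_ne_zero
  have log_eq : Complex.log (Complex.I * κ / 2)
      = (Real.log (κ / 2) : ℂ) + Real.pi / 2 * Complex.I := by
    rw [show Complex.I * (κ : ℂ) / 2 = ((κ / 2 : ℝ) : ℂ) * Complex.I by push_cast; ring,
      Complex.log_ofReal_mul (by positivity) Complex.I_ne_zero, Complex.log_I]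
  rw [gammaMatrix, Matrix.of_apply, if_pos rfl, log_eq]
  push_cast
  field_simp
  ring

theorem tendsto_gammaMatrix_I_mul_offDiag (α : Fin N → ℝ) {y : Fin N → Plane}
    (hy : Function.Injective y) {k j : Fin N} (hkj : k ≠ j) :
    Tendsto (fun κ : ℝ => gammaMatrix α y (Complex.I * κ) k j) atTop (𝓝 0) := by
  simpa only [gammaMatrix, Matrix.of_apply, if_neg hkj, neg_zero] using
    (tendsto_greenKernel_I_mul_atTop (sub_ne_zero.2 (hy.ne hkj))).neg

theorem tendsto_norm_gammaMatrix_I_mul_diag (α : Fin N → ℝ) (y : Fin N → Plane) (k : Fin N) :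
    Tendsto (fun κ : ℝ => ‖gammaMatrix α y (Complex.I * κ) k k‖) atTop atTop := by
  have log_tendsto : Tendsto (fun κ : ℝ => Real.log (κ / 2)) atTop atTop :=
    Real.tendsto_log_atTop.comp (tendsto_id.atTop_div_const two_pos)
  have h : Tendsto (fun κ : ℝ => α k + 1 / (2 * Real.pi)
      * (Real.log (κ / 2) + Real.eulerMascheroniConstant)) atTop atTop :=
    tendsto_atTop_add_const_left _ _ ((tendsto_atTop_add_const_right _ _
      log_tendsto).const_mul_atTop (by positivity))
  refine (tendsto_abs_atTop_atTop.comp h).congr' ?_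
  filter_upwards [eventually_gt_atTop 0] with κ hκ
  rw [gammaMatrix_I_mul_diag α y hκ, Complex.norm_real]
  rfl

-- High up on the imaginary axis `Γ_{α,Y}` is strictly diagonally dominant: its diagonal grows
-- logarithmically and its other entries decay.
theorem admissible_nonempty (α : Fin N → ℝ) {y : Fin N → Plane} (hy : Function.Injective y) :
    (admissible α y).Nonempty := by
  have offDiag_tendsto (k : Fin N) : Tendsto (fun κ : ℝ => ∑ j ∈ Finset.univ.erase k,
      ‖gammaMatrix α y (Complex.I * κ) k j‖) atTop (𝓝 0) := by
    rw [← Finset.sum_const_zero (ι := Fin N) (s := Finset.univ.erase k)]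
    refine tendsto_finsetSum _ fun j hj => ?_
    simpa using (tendsto_gammaMatrix_I_mul_offDiag α hy (Finset.ne_of_mem_erase hj).symm).norm
  have eventually_dominant (k : Fin N) : ∀ᶠ κ : ℝ in atTop, ∑ j ∈ Finset.univ.erase k,
      ‖gammaMatrix α y (Complex.I * κ) k j‖ < ‖gammaMatrix α y (Complex.I * κ) k k‖ := by
    filter_upwards [(offDiag_tendsto k).eventually_lt_const one_pos,
      (tendsto_norm_gammaMatrix_I_mul_diag α y k).eventually_ge_atTop 1] with κ hoff hdiag
    exact hoff.trans_le hdiag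
  obtain ⟨κ, hκ, hdominant⟩ :=
    ((eventually_gt_atTop 0).and (eventually_all.2 eventually_dominant)).exists
  refine ⟨Complex.I * κ, I_mul_ofReal_im_pos hκ, ?_⟩
  rw [Matrix.isUnit_iff_isUnit_det, isUnit_iff_ne_zero]
  exact det_ne_zero_of_sum_row_lt_diag hdominant

end Admissible

/-! ### The kernel of the point interaction -/

section Kernel

variable {N : ℕ} {α : Fin N → ℝ} {y : Fin N → Plane}

theorem domainFunction_eq_add_greenSum (α : Fin N → ℝ) (y : Fin N → Plane) (z : ℂ)
    (v : Plane → ℂ) : domainFunction α y z v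
      = fun x => v x + greenSum z y ((gammaMatrix α y z)⁻¹.mulVec fun k => v (y k)) x := by
  ext x
  simp only [domainFunction, greenSum, Matrix.mulVec, dotProduct, Finset.sum_mul]

theorem sub_smul_eq_neg_laplacian_sub_iff {z : ℂ} (hz : 0 < z.im) {q : Fin N → ℂ}
    {u v f : L2Plane} (huv : u =ᵐ[volume] fun x => v x + greenSum z y q x) :
    ((f - z ^ 2 • u : L2Plane) : 𝓢'(Plane, ℂ))
        = -Δ (v : 𝓢'(Plane, ℂ)) - z ^ 2 • (v : 𝓢'(Plane, ℂ)) ↔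
      (𝓕 f : L2Plane) =ᵐ[volume]
        fun ξ => helmholtzSymbol 0 ξ * (𝓕 u : L2Plane) ξ - expSum y q ξ := by
  set G : L2Plane := (memLp_two_greenSum hz y q).toLp _
  have u_eq : u = v + G := by
    refine Lp.ext ?_
    filter_upwards [huv, Lp.coeFn_add v G, (memLp_two_greenSum hz y q).coeFn_toLp] with x hu hadd hG
    rw [hu, hadd, Pi.add_apply, hG]
  have fourier_u : ∀ᵐ ξ : Plane, (𝓕 u : L2Plane) ξ
      = (𝓕 v : L2Plane) ξ + expSum y q ξ / helmholtzSymbol z ξ := by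
    rw [u_eq, FourierTransform.fourier_add]
    filter_upwards [Lp.coeFn_add (𝓕 v : L2Plane) (𝓕 G), fourier_greenSum hz y q] with ξ hadd hG
    rw [hadd, Pi.add_apply, hG]
  have fourier_sub : ∀ᵐ ξ : Plane, (𝓕 (f - z ^ 2 • u) : L2Plane) ξ
      = (𝓕 f : L2Plane) ξ - z ^ 2 * (𝓕 u : L2Plane) ξ := by
    rw [sub_eq_add_neg, FourierTransform.fourier_add, FourierTransform.fourier_neg,
      FourierTransform.fourier_smul, ← sub_eq_add_neg]
    filter_upwards [Lp.coeFn_sub (𝓕 f : L2Plane) (z ^ 2 • 𝓕 u),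
      Lp.coeFn_smul (z ^ 2) (𝓕 u : L2Plane)] with ξ hsub hsmul
    rw [hsub, Pi.sub_apply, hsmul, Pi.smul_apply, smul_eq_mul]
  rw [eq_neg_laplacian_sub_iff_fourier]
  refine eventually_congr ?_
  filter_upwards [fourier_u, fourier_sub] with ξ hu hsub
  have symbol_mul : helmholtzSymbol z ξ * (𝓕 v : L2Plane) ξ
      = helmholtzSymbol z ξ * (𝓕 u : L2Plane) ξ - expSum y q ξ := by
    rw [hu, mul_add, mul_div_cancel₀ _ (helmholtzSymbol_ne_zero hz ξ), add_sub_cancel_right]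
  have symbol_eq : helmholtzSymbol z ξ = helmholtzSymbol 0 ξ - z ^ 2 := by simp [helmholtzSymbol]
  rw [hsub, symbol_mul, symbol_eq]
  constructor <;> intro h <;> linear_combination h

theorem add_greenSum_ae_eq_iff {z : ℂ} {q : Fin N → ℂ} {u w : Plane → ℂ} :
    (u =ᵐ[volume] fun x => w x + regularSum y z q x + greenSum z y q x) ↔
      u =ᵐ[volume] fun x => w x + logPotential y q x := by
  refine eventually_congr ?_
  filter_upwards [regularSum_ae_eq y z q] with x hx
  rw [hx, add_assoc, sub_add_cancel]

/-- The singular charges of the elements of the graph of `H_{α,Y}`: `q` is the charge of `(u, f)`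
if `u + ∑_j q_j (2π)⁻¹ log |x - y_j|` is a continuous function with value `(𝒟̃ q)_k` at `y_k`, and
`f = -Δ u - ∑_j q_j δ_{y_j}`, an identity stated on the Fourier side. -/
structure IsCharge (α : Fin N → ℝ) (y : Fin N → Plane) (u f : L2Plane) (q : Fin N → ℂ) : Prop where
  exists_regular_part : ∃ w : Plane → ℂ, Continuous w ∧
    (∀ k, w (y k) = ((dMatrix α y).map Complex.ofReal).mulVec q k) ∧
    u =ᵐ[volume] fun x => w x + logPotential y q x
  fourier_ae_eq : (𝓕 f : L2Plane) =ᵐ[volume]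
    fun ξ => helmholtzSymbol 0 ξ * (𝓕 u : L2Plane) ξ - expSum y q ξ

theorem exists_isCharge_of_mem_pointInteractionGraphAt (hy : Function.Injective y) {z : ℂ}
    (hz : z ∈ admissible α y) {u f : L2Plane} (h : (u, f) ∈ pointInteractionGraphAt α y z) :
    ∃ q, IsCharge α y u f q := by
  obtain ⟨v, vc, -, vc_continuous, hv, hu, hf⟩ := h
  set q := (gammaMatrix α y z)⁻¹.mulVec fun k => vc (y k) with hq
  have hΓ : (gammaMatrix α y z).mulVec q = fun k => vc (y k) := by
    rw [hq, Matrix.mulVec_mulVec, Matrix.mul_nonsing_inv _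
      ((Matrix.isUnit_iff_isUnit_det _).1 hz.2), Matrix.one_mulVec]
  rw [domainFunction_eq_add_greenSum, ← hq] at hu
  refine ⟨q, ⟨fun x => vc x - regularSum y z q x,
    vc_continuous.sub (continuous_regularSum hz.1 y q), fun k => ?_, ?_⟩, ?_⟩
  · simp only [regularSum_apply_point α hy, hΓ, sub_sub_cancel]
  · rw [← add_greenSum_ae_eq_iff (z := z)]
    simpa only [sub_add_cancel] using hu
  · refine (sub_smul_eq_neg_laplacian_sub_iff hz.1 ?_).1 hf
    filter_upwards [hu, hv] with x hux hvx
    rw [hux, hvx]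

theorem IsCharge.mem_pointInteractionGraphAt (hy : Function.Injective y) {z : ℂ}
    (hz : z ∈ admissible α y) {u f : L2Plane} {q : Fin N → ℂ} (h : IsCharge α y u f q) :
    (u, f) ∈ pointInteractionGraphAt α y z := by
  obtain ⟨⟨w, w_continuous, hw, hu⟩, hf⟩ := h
  set G : L2Plane := (memLp_two_greenSum hz.1 y q).toLp _
  set vc : Plane → ℂ := fun x => w x + regularSum y z q x
  have hu_vc : u =ᵐ[volume] fun x => vc x + greenSum z y q x := add_greenSum_ae_eq_iff.2 hu
  have hG := (memLp_two_greenSum hz.1 y q).coeFn_toLp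
  have hv : (u - G : L2Plane) =ᵐ[volume] vc := by
    filter_upwards [Lp.coeFn_sub u G, hu_vc, hG] with x hsub hux hGx
    rw [hsub, Pi.sub_apply, hux, hGx, add_sub_cancel_right]
  have charge_eq : (gammaMatrix α y z)⁻¹.mulVec (fun k => vc (y k)) = q := by
    have : (fun k => vc (y k)) = (gammaMatrix α y z).mulVec q := by
      ext k
      simp only [vc, hw, regularSum_apply_point α hy, add_sub_cancel]
    rw [this, Matrix.mulVec_mulVec, Matrix.nonsing_inv_mul _
      ((Matrix.isUnit_iff_isUnit_det _).1 hz.2), Matrix.one_mulVec]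
  have laplacian_eq := (sub_smul_eq_neg_laplacian_sub_iff (v := u - G) hz.1 (by
    filter_upwards [hu_vc, hv] with x hux hvx
    rw [hux, hvx])).2 hf
  refine ⟨u - G, vc, memSobolev_two_of_fourier_ae_eq
    ((eq_neg_laplacian_sub_iff_fourier _ _ z).1 laplacian_eq),
    w_continuous.add (continuous_regularSum hz.1 y q), hv, ?_, laplacian_eq⟩
  rwa [domainFunction_eq_add_greenSum, charge_eq]

theorem mem_iInf_pointInteractionGraphAt_iff (hy : Function.Injective y) {u f : L2Plane} :
    (u, f) ∈ ⨅ z ∈ admissible α y, pointInteractionGraphAt α y z ↔ ∃ q, IsCharge α y u f q := by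
  simp only [Submodule.mem_iInf]
  constructor
  · obtain ⟨z, hz⟩ := admissible_nonempty α hy
    exact fun h => exists_isCharge_of_mem_pointInteractionGraphAt hy hz (h z hz)
  · rintro ⟨q, hq⟩ z hz
    exact hq.mem_pointInteractionGraphAt hy hz

theorem IsCharge.eq_zero (hy : Function.Injective y) {f : L2Plane} {q : Fin N → ℂ}
    (h : IsCharge α y 0 f q) : f = 0 := by
  obtain ⟨⟨w, w_continuous, -, hu⟩, hf⟩ := h
  have hq : q = 0 := by
    refine eq_zero_of_logPotential_ae_eq hy w_continuous.neg ?_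
    filter_upwards [hu, Lp.coeFn_zero ℂ 2 (volume : Measure Plane)] with x hx hx_zero
    rw [hx_zero, Pi.zero_apply] at hx
    rw [Pi.neg_apply]
    linear_combination -hx
  have fourier_f : (𝓕 f : L2Plane) = 0 := by
    rw [Lp.eq_zero_iff_ae_eq_zero]
    rw [FourierTransform.fourier_zero] at hf
    filter_upwards [hf, Lp.coeFn_zero ℂ 2 (volume : Measure Plane)] with ξ hξ hξ_zero
    rw [hξ, hξ_zero, hq, Pi.zero_apply, mul_zero, zero_sub, neg_eq_zero]
    simp [expSum]
  rw [← norm_eq_zero, ← Lp.norm_fourier_eq, fourier_f, norm_zero]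

theorem mem_graph_pointInteraction_iff (hy : Function.Injective y) {u f : L2Plane} :
    (u, f) ∈ (pointInteraction α y).graph ↔ ∃ q, IsCharge α y u f q := by
  rw [pointInteraction, Submodule.toLinearPMap_graph_eq, mem_iInf_pointInteractionGraphAt_iff hy]
  rintro ⟨u, f⟩ h rfl
  obtain ⟨q, hq⟩ := (mem_iInf_pointInteractionGraphAt_iff hy).1 h
  exact hq.eq_zero hy

/-- The complex vectors `q` satisfying `(*)`: the charge and the dipole moment of `∑_j q_j δ_{y_j}`
vanish and `𝒟̃ q = 0`. -/
structure IsNullCharge (α : Fin N → ℝ) (y : Fin N → Plane) (q : Fin N → ℂ) : Prop where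
  sum_eq_zero : ∑ j, q j = 0
  sum_mul_apply_eq_zero : ∀ i : Fin 2, ∑ j, q j * (y j i : ℂ) = 0
  mulVec_eq_zero : ((dMatrix α y).map Complex.ofReal).mulVec q = 0

theorem IsNullCharge.memLp_two_logPotential {q : Fin N → ℂ} (h : IsNullCharge α y q) :
    MemLp (logPotential y q) 2 volume :=
  _root_.memLp_two_logPotential h.sum_eq_zero (dipoleForm_eq_zero_iff.2 h.sum_mul_apply_eq_zero)

theorem isCharge_zero_iff {ψ : L2Plane} {q : Fin N → ℂ} :
    IsCharge α y ψ 0 q ↔ IsNullCharge α y q ∧ ψ =ᵐ[volume] logPotential y q := by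
  have fourier_iff : ((𝓕 (0 : L2Plane) : L2Plane) =ᵐ[volume]
      fun ξ => helmholtzSymbol 0 ξ * (𝓕 ψ : L2Plane) ξ - expSum y q ξ) ↔
      ∑ j, q j = 0 ∧ dipoleForm y q = 0 ∧ ψ =ᵐ[volume] logPotential y q := by
    rw [← fourier_eq_expSum_div_iff, FourierTransform.fourier_zero]
    refine eventually_congr ?_
    filter_upwards [Lp.coeFn_zero ℂ 2 (volume : Measure Plane), ae_ne_zero_plane] with ξ hzero hξ
    have symbol_ne_zero : helmholtzSymbol 0 ξ ≠ 0 := by simp [helmholtzSymbol, hξ, Real.pi_ne_zero]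
    rw [hzero, Pi.zero_apply, eq_comm, sub_eq_zero, eq_div_iff symbol_ne_zero, mul_comm]
  constructor
  · rintro ⟨⟨w, w_continuous, hw, hψw⟩, hψ⟩
    obtain ⟨hsum, hdipole, hψ⟩ := fourier_iff.1 hψ
    have w_eq_zero : w = fun _ => 0 := by
      refine (w_continuous.ae_eq_iff_eq volume continuous_const).1 ?_
      filter_upwards [hψ, hψw] with x hx hxw
      simpa [hx] using hxw
    refine ⟨⟨hsum, dipoleForm_eq_zero_iff.1 hdipole, ?_⟩, hψ⟩
    ext k
    rw [← hw, w_eq_zero, Pi.zero_apply]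
  · rintro ⟨⟨hsum, hmoments, hD⟩, hψ⟩
    refine ⟨⟨fun _ => 0, continuous_const, fun k => by rw [hD, Pi.zero_apply], ?_⟩,
      fourier_iff.2 ⟨hsum, dipoleForm_eq_zero_iff.2 hmoments, hψ⟩⟩
    simpa only [zero_add] using hψ

theorem pointInteraction_eq_zero_iff (hy : Function.Injective y) {ψ : L2Plane} :
    (∃ hψ : ψ ∈ (pointInteraction α y).domain, pointInteraction α y ⟨ψ, hψ⟩ = 0) ↔
      ∃ q, IsNullCharge α y q ∧ ψ =ᵐ[volume] logPotential y q := by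
  simp only [← isCharge_zero_iff, ← mem_graph_pointInteraction_iff hy, LinearPMap.mem_graph_iff,
    Subtype.exists, exists_and_left, exists_eq_left]

theorem eq_zero_iff_of_ae_eq_logPotential (hy : Function.Injective y) {ψ : L2Plane}
    {q : Fin N → ℂ} (hψ : ψ =ᵐ[volume] logPotential y q) : ψ = 0 ↔ q = 0 := by
  rw [Lp.eq_zero_iff_ae_eq_zero]
  constructor
  · exact fun h => eq_zero_of_logPotential_ae_eq hy continuous_zero (hψ.symm.trans h)
  · rintro rfl
    filter_upwards [hψ] with x hx
    simp [hx, logPotential]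

theorem isNullCharge_ofReal_iff {a : Fin N → ℝ} : IsNullCharge α y (fun j => (a j : ℂ)) ↔
    ∑ j, a j = 0 ∧ ∑ j, a j • y j = 0 ∧ (dMatrix α y).mulVec a = 0 := by
  have sum_smul_iff : ∑ j, a j • y j = 0 ↔ ∀ i : Fin 2, ∑ j, a j * y j i = 0 := by
    rw [PiLp.ext_iff]
    simp
  have mulVec_iff : ((dMatrix α y).map Complex.ofReal).mulVec (fun j => (a j : ℂ)) = 0 ↔
      (dMatrix α y).mulVec a = 0 := by
    simp only [funext_iff, Matrix.mulVec, dotProduct, Matrix.map_apply, Pi.zero_apply]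
    norm_cast
  rw [sum_smul_iff, ← mulVec_iff]
  refine ⟨fun ⟨hsum, hmoments, hD⟩ => ⟨?_, fun i => ?_, hD⟩,
    fun ⟨hsum, hmoments, hD⟩ => ⟨?_, fun i => ?_, hD⟩⟩
  · exact_mod_cast hsum
  · exact_mod_cast hmoments i
  · exact_mod_cast hsum
  · exact_mod_cast hmoments i

theorem logPotential_im (y : Fin N → Plane) (q : Fin N → ℂ) (x : Plane) :
    logPotential y (fun j => ((q j).im : ℂ)) x = ((logPotential y q x).im : ℂ) := by
  have coeff_eq (j : Fin N) : q j / (2 * (Real.pi : ℂ)) * (Real.log ‖x - y j‖ : ℂ)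
      = q j * (Real.log ‖x - y j‖ / (2 * Real.pi) : ℝ) := by
    push_cast
    ring
  simp only [logPotential, coeff_eq, Complex.neg_im, Complex.im_sum, Complex.im_mul_ofReal]
  push_cast
  refine congrArg _ (Finset.sum_congr rfl fun j _ => ?_)
  ring

theorem im_eq_zero_of_ae_eq_logPotential (hy : Function.Injective y) {ψ : Plane → ℂ}
    {q : Fin N → ℂ} (hψ : ψ =ᵐ[volume] logPotential y q) (hreal : ∀ᵐ x, (ψ x).im = 0) (j : Fin N) :
    (q j).im = 0 := by
  have : (fun j => ((q j).im : ℂ)) = 0 := by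
    refine eq_zero_of_logPotential_ae_eq hy continuous_zero ?_
    filter_upwards [hψ, hreal] with x hx hx_real
    rw [logPotential_im, ← hx, hx_real, Complex.ofReal_zero, Pi.zero_apply]
  exact Complex.ofReal_eq_zero.1 (congrFun this j)

end Kernel

end

theorem proposition1p2_general {N : ℕ} (α : Fin N → ℝ) (y : Fin N → Plane)
    (hy : Function.Injective y) :
    (∀ a : Fin N → ℝ, a ≠ 0 → ∑ j, a j = 0 → ∑ j, a j • y j = 0 →
      Matrix.mulVec (dMatrix α y) a = 0 →
      ∃ ψ : L2Plane, (ψ : Plane → ℂ) =ᵐ[volume] logPotential y (fun j => (a j : ℂ)) ∧ ψ ≠ 0 ∧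
        ∃ hψ : ψ ∈ (pointInteraction α y).domain, pointInteraction α y ⟨ψ, hψ⟩ = 0) ∧
    (∀ (ψ : L2Plane) (hψ : ψ ∈ (pointInteraction α y).domain), ψ ≠ 0 →
      pointInteraction α y ⟨ψ, hψ⟩ = 0 → (∀ᵐ x, ((ψ : Plane → ℂ) x).im = 0) →
      ∃ a : Fin N → ℝ, a ≠ 0 ∧ ∑ j, a j = 0 ∧ ∑ j, a j • y j = 0 ∧
        Matrix.mulVec (dMatrix α y) a = 0 ∧
        (ψ : Plane → ℂ) =ᵐ[volume] logPotential y (fun j => (a j : ℂ))) ∧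
    (∀ (ψ : L2Plane) (hψ : ψ ∈ (pointInteraction α y).domain), ψ ≠ 0 →
      pointInteraction α y ⟨ψ, hψ⟩ = 0 →
      ∃ c : Fin N → ℂ, c ≠ 0 ∧ ∑ j, c j = 0 ∧ (∀ i : Fin 2, ∑ j, c j * ((y j i : ℝ) : ℂ) = 0) ∧
        Matrix.mulVec ((dMatrix α y).map Complex.ofReal) c = 0 ∧
        (ψ : Plane → ℂ) =ᵐ[volume] logPotential y c) := by
  refine ⟨fun a ha hsum hmoments hD => ?_, fun ψ hψ ψ_ne_zero h hreal => ?_,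
    fun ψ hψ ψ_ne_zero h => ?_⟩
  · have null : IsNullCharge α y fun j => (a j : ℂ) :=
      isNullCharge_ofReal_iff.2 ⟨hsum, hmoments, hD⟩
    have ψ_ae_eq := null.memLp_two_logPotential.coeFn_toLp
    refine ⟨_, ψ_ae_eq, fun h => ha ?_, (pointInteraction_eq_zero_iff hy).2 ⟨_, null, ψ_ae_eq⟩⟩
    simpa [funext_iff] using (eq_zero_iff_of_ae_eq_logPotential hy ψ_ae_eq).1 h
  · obtain ⟨q, null, ψ_ae_eq⟩ := (pointInteraction_eq_zero_iff hy).1 ⟨hψ, h⟩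
    obtain ⟨a, rfl⟩ : ∃ a : Fin N → ℝ, q = fun j => (a j : ℂ) :=
      ⟨fun j => (q j).re, funext fun j =>
        Complex.ext rfl (im_eq_zero_of_ae_eq_logPotential hy ψ_ae_eq hreal j)⟩
    obtain ⟨hsum, hmoments, hD⟩ := isNullCharge_ofReal_iff.1 null
    refine ⟨a, ?_, hsum, hmoments, hD, ψ_ae_eq⟩
    rintro rfl
    exact ψ_ne_zero ((eq_zero_iff_of_ae_eq_logPotential hy ψ_ae_eq).2 (by ext; simp))
  · obtain ⟨q, null, ψ_ae_eq⟩ := (pointInteraction_eq_zero_iff hy).1 ⟨hψ, h⟩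
    exact ⟨q, fun hq => ψ_ne_zero ((eq_zero_iff_of_ae_eq_logPotential hy ψ_ae_eq).2 hq),
      null.sum_eq_zero, null.sum_mul_apply_eq_zero, null.mulVec_eq_zero, ψ_ae_eq⟩

theorem proposition1p2 {N : ℕ} (hN : 3 ≤ N) (α : Fin N → ℝ) (y : Fin N → Plane)
    (hy : Function.Injective y) :
    -- the function of a real vector `a` is a zero-energy eigenfunction
    (∀ a : Fin N → ℝ, a ≠ 0 → ∑ j, a j = 0 → ∑ j, a j • y j = 0 →
      Matrix.mulVec (dMatrix α y) a = 0 →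
      ∃ ψ : L2Plane, (ψ : Plane → ℂ) =ᵐ[volume] logPotential y (fun j => (a j : ℂ)) ∧ ψ ≠ 0 ∧
        ∃ hψ : ψ ∈ (pointInteraction α y).domain, pointInteraction α y ⟨ψ, hψ⟩ = 0) ∧
    -- every real zero-energy eigenfunction comes from a real vector
    (∀ (ψ : L2Plane) (hψ : ψ ∈ (pointInteraction α y).domain), ψ ≠ 0 →
      pointInteraction α y ⟨ψ, hψ⟩ = 0 → (∀ᵐ x, ((ψ : Plane → ℂ) x).im = 0) →
      ∃ a : Fin N → ℝ, a ≠ 0 ∧ ∑ j, a j = 0 ∧ ∑ j, a j • y j = 0 ∧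
        Matrix.mulVec (dMatrix α y) a = 0 ∧
        (ψ : Plane → ℂ) =ᵐ[volume] logPotential y (fun j => (a j : ℂ))) ∧
    -- every complex zero-energy eigenfunction comes from a complex vector
    (∀ (ψ : L2Plane) (hψ : ψ ∈ (pointInteraction α y).domain), ψ ≠ 0 →
      pointInteraction α y ⟨ψ, hψ⟩ = 0 →
      ∃ c : Fin N → ℂ, c ≠ 0 ∧ ∑ j, c j = 0 ∧ (∀ i : Fin 2, ∑ j, c j * ((y j i : ℝ) : ℂ) = 0) ∧
        Matrix.mulVec ((dMatrix α y).map Complex.ofReal) c = 0 ∧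
        (ψ : Plane → ℂ) =ᵐ[volume] logPotential y c) :=
  proposition1p2_general α y hy
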